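/- Let $a>b>c>0$ and let $\mathcal E=\{x^2/a^2+y^2/b^2+z^2/c^2=1\}$. Put $$k=\sqrt{\tfrac{a^2-b^2}{a^2-c^2}},\qquad k'=\sqrt{1-k^2}=\sqrt{\tfrac{b^2-c^2}{a^2-c^2}},\qquad K=K(k),\qquad K'=K(k'),$$ where $K(\cdot)$ is the complete elliptic integral of the first kind, and, with Jacobi's elliptic functions, $$p(s)=\bigl(c^2\,\mathrm{cn}^2(s,k')+b^2\,\mathrm{sn}^2(s,k')\bigr)^{1/2},\qquad q(t)=\bigl(a^2\,\mathrm{cn}^2(t,k)+b^2\,\mathrm{sn}^2(t,k)\bigr)^{1/2}.$$ Separation of variables in ellipsoidal coordinates turns the equation $-\Delta_{\mathcal E}u=\lambda u$ for the Laplace--Beltrami operator of $\mathcal E$ into the two-parameter Sturm--Liouville system $$\Bigl(\tfrac1{p}v'\Bigr)'+p\,\bigl(-h+\lambda\,\mathrm{dn}^2(s,k')\bigr)v=0\quad(0\le s\le K'),\qquad \Bigl(\tfrac1{q}w'\Bigr)'+q\,\bigl(h-\lambda k^2\,\mathrm{sn}^2(t,k)\bigr)w=0\quad(0\le t\le K).$$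 For a parity $\kappa=(\kappa_1,\kappa_2,\kappa_3)\in\{0,1\}^3$ impose the boundary conditions - $v'(0)=0$ if $\kappa_3=0$, and $v(0)=0$ if $\kappa_3=1$; - $v'(K')=w'(K)=0$ if $\kappa_2=0$, and $v(K')=w(K)=0$ if $\kappa_2=1$; - $w'(0)=0$ if $\kappa_1=0$, and $w(0)=0$ if $\kappa_1=1$. For integers $m,n\ge 0$ let $\lambda_{m,n,\kappa}(a,b,c)$ be the real number $\lambda$ for which there is a real $h$ such that the first equation has a nontrivial solution $v$ satisfying its boundary conditions with exactly $m$ zeros in $(0,K')$ and the second equation has a nontrivial solution $w$ satisfying its boundary conditions with exactly $n$ zeros in $(0,K)$. Let $$\Lambda_{m,n,\kappa}=(2m+2n+|\kappa|)(2m+2n+|\kappa|+1),\qquad |\kappa|=\kappa_1+\kappa_2+\kappa_3,$$ which are the eigenvalues in the corresponding problem for the unit sphere, and put $\hat\kappa=(\kappa_1,1,\kappa_3)$. **Theorem.** For all $a>b>c>0$, all integers $m,n\ge0$ and all $\kappa\in\{0,1\}^3$, the number $\lambda_{m,n,\kappa}(a,b,c)$ is well defined, that is, there is exactly one such real $\lambda$,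 and the following holds. 1. If $\kappa_2=1$, then $a^{-2}\Lambda_{m,n,\kappa}<\lambda_{m,n,\kappa}(a,b,c)<c^{-2}\Lambda_{m,n,\kappa}$. 2. If $\kappa_2=0$, then $\lambda_{m,n,\kappa}(a,b,c)<c^{-2}\Lambda_{m,n,\hat\kappa}$. 3. If $\kappa_2=0$ and $m,n\ge1$, then $a^{-2}\Lambda_{m-1,n-1,\hat\kappa}<\lambda_{m,n,\kappa}(a,b,c)$. -/

import Mathlib

open Set

noncomputable section

/-- The incomplete elliptic integral of the first kind
`F(φ, k) = ∫₀^φ (1 - k² sin² θ)^{-1/2} dθ`. -/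
def ellipticF (k φ : ℝ) : ℝ :=
  ∫ θ in (0 : ℝ)..φ, 1 / √(1 - k ^ 2 * Real.sin θ ^ 2)

/-- The complete elliptic integral `K(k) = F(π/2, k)`. -/
def ellipticK (k : ℝ) : ℝ := ellipticF k (Real.pi / 2)

/-- The Jacobi amplitude `am(u, k)`: the inverse function of `φ ↦ F(φ, k)`. -/
def jacobiAm (u k : ℝ) : ℝ := Function.invFun (ellipticF k) u

def jacobiSn (u k : ℝ) : ℝ := Real.sin (jacobiAm u k)

def jacobiCn (u k : ℝ) : ℝ := Real.cos (jacobiAm u k)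

def jacobiDn (u k : ℝ) : ℝ := √(1 - k ^ 2 * jacobiSn u k ^ 2)

theorem ellipticF_integrand_pos {k : ℝ} (hk : k ^ 2 < 1) (θ : ℝ) :
    0 < 1 - k ^ 2 * Real.sin θ ^ 2 := by
  nlinarith [Real.sin_sq_le_one θ, sq_nonneg k, sq_nonneg (Real.sin θ)]

theorem continuous_ellipticF_integrand {k : ℝ} (hk : k ^ 2 < 1) :
    Continuous fun θ : ℝ => 1 / √(1 - k ^ 2 * Real.sin θ ^ 2) :=
  continuous_const.div (by fun_prop)
    fun θ => (Real.sqrt_pos.2 (ellipticF_integrand_pos hk θ)).ne'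

theorem sub_le_ellipticF_sub {k : ℝ} (hk : k ^ 2 < 1) {x y : ℝ} (hxy : x ≤ y) :
    y - x ≤ ellipticF k y - ellipticF k x := by
  have hc := continuous_ellipticF_integrand hk
  unfold ellipticF
  rw [intervalIntegral.integral_interval_sub_left (hc.intervalIntegrable _ _)
    (hc.intervalIntegrable _ _)]
  have h1 : ∫ _ in x..y, (1 : ℝ) = y - x := by simp
  rw [← h1]
  refine intervalIntegral.integral_mono_on hxy (by simp) (hc.intervalIntegrable _ _) ?_
  intro θ _
  have hp := ellipticF_integrand_pos hk θ
  rw [le_div_iff₀ (Real.sqrt_pos.2 hp), one_mul]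
  refine Real.sqrt_le_one.2 ?_
  nlinarith [mul_nonneg (sq_nonneg k) (sq_nonneg (Real.sin θ))]

/-- For a modulus `|k| < 1` the amplitude is a genuine inverse of `F(·, k) : ℝ → ℝ`. -/
theorem ellipticF_bijective {k : ℝ} (hk : k ^ 2 < 1) :
    Function.Bijective (ellipticF k) := by
  have hc := continuous_ellipticF_integrand hk
  have hcont : Continuous (ellipticF k) :=
    intervalIntegral.continuous_primitive (fun a b => hc.intervalIntegrable a b) 0
  have h0 : ellipticF k 0 = 0 := by simp [ellipticF]
  refine ⟨StrictMono.injective fun x y hxy => ?_, hcont.surjective ?_ ?_⟩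
  · linarith [sub_le_ellipticF_sub hk hxy.le]
  · refine Filter.tendsto_atTop_mono' _ ?_ Filter.tendsto_id
    filter_upwards [Filter.eventually_ge_atTop 0] with x hx
    have := sub_le_ellipticF_sub hk hx
    simp only [id]
    linarith
  · refine Filter.tendsto_atBot_mono' _ ?_ Filter.tendsto_id
    filter_upwards [Filter.eventually_le_atBot 0] with x hx
    have := sub_le_ellipticF_sub hk hx
    simp only [id]
    linarith

/-- The modulus `k` of the ellipsoid with semi-axes `a > b > c`. -/
def modulus (a b c : ℝ) : ℝ := √((a ^ 2 - b ^ 2) / (a ^ 2 - c ^ 2))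

/-- The complementary modulus `k'`, with `k² + k'² = 1`. -/
def coModulus (a b c : ℝ) : ℝ := √((b ^ 2 - c ^ 2) / (a ^ 2 - c ^ 2))

/-- `y` (with derivative `dy`) solves `((1/r) y')' + r g y = 0` on `[0, L]`, the derivatives
at the end points being one-sided. -/
structure IsSLSolution (L : ℝ) (r g y dy : ℝ → ℝ) : Prop where
  hasDeriv : ∀ x ∈ Icc 0 L, HasDerivWithinAt y (dy x) (Icc 0 L) x
  equation : ∀ x ∈ Icc 0 L,
    HasDerivWithinAt (fun ξ => 1 / r ξ * dy ξ) (-(r x * g x * y x)) (Icc 0 L) x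

/-- The boundary condition at `x`: Neumann for parity `0`, Dirichlet for parity `1`. -/
def ParityBC (κ : Fin 2) (y dy : ℝ → ℝ) (x : ℝ) : Prop :=
  if κ = 0 then dy x = 0 else y x = 0

/-- The equation `((1/r) y')' + r g y = 0` on `[0, L]` has a nontrivial solution that satisfies
the boundary conditions of parity `κ₀` at `0` and of parity `κL` at `L` and has exactly `j` zeros
in the open interval `(0, L)`. -/
def HasEigenfunction (L : ℝ) (r g : ℝ → ℝ) (κ₀ κL : Fin 2) (j : ℕ) : Prop :=
  ∃ y dy : ℝ → ℝ, IsSLSolution L r g y dy ∧ (∃ x ∈ Icc 0 L, y x ≠ 0) ∧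
    ParityBC κ₀ y dy 0 ∧ ParityBC κL y dy L ∧
    {x ∈ Ioo 0 L | y x = 0}.encard = j

/-- `p(s) = (c² cn²(s,k') + b² sn²(s,k'))^{1/2}`. -/
def pCoeff (a b c s : ℝ) : ℝ :=
  √(c ^ 2 * jacobiCn s (coModulus a b c) ^ 2 + b ^ 2 * jacobiSn s (coModulus a b c) ^ 2)

/-- `q(t) = (a² cn²(t,k) + b² sn²(t,k))^{1/2}`. -/
def qCoeff (a b c t : ℝ) : ℝ :=
  √(a ^ 2 * jacobiCn t (modulus a b c) ^ 2 + b ^ 2 * jacobiSn t (modulus a b c) ^ 2)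

/-- The relation `h = H_{m,κ}(lam; a,b,c)`: the point `(lam, h)` lies on the `m`-th eigencurve of
`((1/p) v')' + p (-h + lam dn²(s,k')) v = 0` on `[0, K']`, with the boundary condition of parity
`κ₃` at `0` and of parity `κ₂` at `K'`. -/
def OnEigencurveH (a b c : ℝ) (κ₂ κ₃ : Fin 2) (m : ℕ) (lam h : ℝ) : Prop :=
  HasEigenfunction (ellipticK (coModulus a b c)) (pCoeff a b c)
    (fun s => -h + lam * jacobiDn s (coModulus a b c) ^ 2) κ₃ κ₂ m

/-- The relation `h = h_{n,κ}(lam; a,b,c)`: the point `(lam, h)` lies on the `n`-th eigencurve of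
`((1/q) w')' + q (h - lam k² sn²(t,k)) w = 0` on `[0, K]`, with the boundary condition of parity
`κ₁` at `0` and of parity `κ₂` at `K`. -/
def OnEigencurveh (a b c : ℝ) (κ₁ κ₂ : Fin 2) (n : ℕ) (lam h : ℝ) : Prop :=
  HasEigenfunction (ellipticK (modulus a b c)) (qCoeff a b c)
    (fun t => h - lam * modulus a b c ^ 2 * jacobiSn t (modulus a b c) ^ 2) κ₁ κ₂ n

/-- The relation `lam = λ_{m,n,κ}(a,b,c)`: the eigencurves `H_{m,κ}` and `h_{n,κ}` meet above
`lam`. -/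
def IsEllipsoidEigenvalue (a b c : ℝ) (κ₁ κ₂ κ₃ : Fin 2) (m n : ℕ) (lam : ℝ) : Prop :=
  ∃ h : ℝ, OnEigencurveH a b c κ₂ κ₃ m lam h ∧ OnEigencurveh a b c κ₁ κ₂ n lam h

/-- `Λ_{m,n,κ} = (2m+2n+|κ|)(2m+2n+|κ|+1)` with `|κ| = κ₁ + κ₂ + κ₃`. -/
def sphereEigenvalue (κ₁ κ₂ κ₃ : Fin 2) (m n : ℕ) : ℝ :=
  (2 * m + 2 * n + (κ₁.val + κ₂.val + κ₃.val)) * (2 * m + 2 * n + (κ₁.val + κ₂.val + κ₃.val) + 1)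

end

/-! Writing y = ρ sin θ and y'/r = ρ cos θ turns each Sturm–Liouville equation into the first-order
equation θ' = r (cos² θ + g sin² θ). An eigenfunction with j interior zeros is the same thing as a
Prüfer angle running from `startAngle` to `targetAngle` (`hasEigenfunction_iff`), so everything
reduces to comparing sub- and supersolutions (`prufer_comparison`).

The two potentials have the form -h + λ W₁ and h + λ W₂ with W₁ = dn² and W₂ = -k² sn². Both W's
decrease, and their values at the right ends add up to 0. Hence, when λ grows, at least one of the
two potentials grows pointwise, however h changes (`potential_le_or_le`). As a larger potential
gives a larger end angle, λ is unique and monotone in the target angles. For existence, each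
equation defines a continuous eigencurve; an intermediate value argument makes the two curves meet
at some λ ≥ 0.

The bounds come from comparing the coefficients p, q with constants, c ≤ p, q ≤ a. Raising r helps
the angle only where cos² θ + g sin² θ ≥ 0; this holds throughout if g is nonincreasing and the
right end is Dirichlet (`IsPruferAngle.energy_nonneg`). So λ decreases when the coefficients
increase, provided the problem with the smaller coefficients is Dirichlet. That problem is the
sphere of radius c for the upper bounds, and the ellipsoid itself for the lower one. When κ₂ = 0,
the lower bound is inherited from the Dirichlet problem with one zero fewer in each variable, whose
target angles are smaller.

For constant coefficients the eigenvalue is explicit: Stieltjes' maximum argument yields a Lamé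
polynomial with n roots in (0, 1) and m roots in (1, k⁻²), and this one polynomial solves both
equations (`exists_sphere_eigenfunctions`). -/

/-! ### The Prüfer equation and its comparison principle. -/

/-- The right-hand side of the Prüfer equation `θ' = r (cos² θ + g sin² θ)`. -/
noncomputable def pruferField (r g : ℝ → ℝ) (x θ : ℝ) : ℝ :=
  r x * (Real.cos θ ^ 2 + g x * Real.sin θ ^ 2)

/-- `θ` is a Prüfer angle of `((1/r) y')' + r g y = 0` on `[a, b]`. -/
def IsPruferAngle (a b : ℝ) (r g θ : ℝ → ℝ) : Prop :=
  ∀ x ∈ Icc a b, HasDerivWithinAt θ (pruferField r g x (θ x)) (Icc a b) x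

theorem IsPruferAngle.continuousOn {a b : ℝ} {r g θ : ℝ → ℝ} (h : IsPruferAngle a b r g θ) :
    ContinuousOn θ (Icc a b) := fun x hx => (h x hx).continuousWithinAt

theorem IsPruferAngle.mono {a b a' b' : ℝ} {r g θ : ℝ → ℝ} (h : IsPruferAngle a b r g θ)
    (ha : a ≤ a') (hb : b' ≤ b) : IsPruferAngle a' b' r g θ := fun x hx =>
  (h x (Icc_subset_Icc ha hb hx)).mono (Icc_subset_Icc ha hb)

theorem exists_antideriv {a b : ℝ} {k : ℝ → ℝ} (hk : ContinuousOn k (Icc a b)) :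
    ∃ κ : ℝ → ℝ, ∀ x ∈ Icc a b, HasDerivWithinAt κ (k x) (Icc a b) x := by
  rcases le_total a b with hab | hab
  · set K : ℝ → ℝ := IccExtend hab ((Icc a b).domRestrict k)
    have hK : Continuous K := (continuousOn_iff_continuous_domRestrict.1 hk).Icc_extend'
    refine ⟨fun x => ∫ t in a..x, K t, fun x hx => ?_⟩
    have hx' : K x = k x := by
      simp [K, IccExtend_of_mem hab _ hx, domRestrict_apply]
    rw [← hx']
    exact (intervalIntegral.integral_hasDerivAt_right (hK.intervalIntegrable _ _)
      (hK.stronglyMeasurableAtFilter _ _) hK.continuousAt).hasDerivWithinAt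
  · refine ⟨k, fun x hx => ?_⟩
    obtain rfl : a = b := le_antisymm (hx.1.trans hx.2) hab
    rw [Icc_self, mem_singleton_iff] at hx
    rw [Icc_self, hx]
    exact HasFDerivWithinAt.of_subsingleton subsingleton_singleton

/-- Such a u vanishes everywhere or nowhere; `IsSLSolution.exists_polar` uses both alternatives. -/
theorem eq_mul_exp_of_linear {a b : ℝ} {k u : ℝ → ℝ} (hk : ContinuousOn k (Icc a b))
    (hu : ∀ x ∈ Icc a b, HasDerivWithinAt u (k x * u x) (Icc a b) x) :
    ∃ κ : ℝ → ℝ, ∀ x ∈ Icc a b, u x = u a * Real.exp (κ x) := by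
  obtain ⟨κ, hκ⟩ := exists_antideriv hk
  have hD : ∀ x ∈ Icc a b,
      HasDerivWithinAt (fun x => u x * Real.exp (-κ x)) 0 (Icc a b) x := fun x hx => by
    refine ((hu x hx).fun_mul (hκ x hx).fun_neg.exp).congr_deriv ?_
    ring
  have hconst := constant_of_has_deriv_right_zero (a := a) (b := b)
    (fun x hx => (hD x hx).continuousWithinAt)
    (fun x hx => ((hD x (Ico_subset_Icc_self hx)).mono_of_mem_nhdsWithin
      (Icc_mem_nhdsGE_of_mem hx)))
  refine ⟨fun x => κ x - κ a, fun x hx => ?_⟩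
  have h := hconst x hx
  have h1 : u x = u x * Real.exp (-κ x) * Real.exp (κ x) := by
    rw [mul_assoc, ← Real.exp_add]; simp
  rw [h1, h, mul_assoc, ← Real.exp_add]
  ring_nf

/-- Since sin² β - sin² α = sin (β + α) sin (β - α), the difference is β - α times a coefficient
that `Real.sinc` keeps continuous at α = β. This gives both the integrating factor of the comparison
principle and the Lipschitz bound. -/
theorem pruferField_sub (r g : ℝ → ℝ) (x α β : ℝ) :
    pruferField r g x β - pruferField r g x α =
      r x * (g x - 1) * Real.sin (β + α) * Real.sinc (β - α) * (β - α) := by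
  have hs : Real.sinc (β - α) * (β - α) = Real.sin (β - α) := by
    by_cases h : β - α = 0
    · simp [h]
    · rw [Real.sinc_of_ne_zero h, div_mul_cancel₀ _ h]
  have h2 : Real.sin (β + α) * Real.sin (β - α) = Real.sin β ^ 2 - Real.sin α ^ 2 := by
    rw [Real.sin_add, Real.sin_sub]
    linear_combination Real.sin β ^ 2 * (Real.sin_sq_add_cos_sq α)
      - Real.sin α ^ 2 * (Real.sin_sq_add_cos_sq β)
  rw [mul_assoc, hs, mul_assoc, h2, pruferField, pruferField]
  linear_combination r x * (Real.sin_sq_add_cos_sq β) - r x * (Real.sin_sq_add_cos_sq α)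

/-- Comparison of a subsolution `α` with a supersolution `β` of the Prüfer equation. -/
theorem prufer_comparison {a b : ℝ} {r g α β dα dβ : ℝ → ℝ}
    (hr : Continuous r) (hg : Continuous g)
    (hα : ∀ x ∈ Icc a b, HasDerivWithinAt α (dα x) (Icc a b) x)
    (hβ : ∀ x ∈ Icc a b, HasDerivWithinAt β (dβ x) (Icc a b) x)
    (hsub : ∀ x ∈ Icc a b, dα x ≤ pruferField r g x (α x))
    (hsup : ∀ x ∈ Icc a b, pruferField r g x (β x) ≤ dβ x) (h0 : α a ≤ β a) :
    (∀ x ∈ Icc a b, α x ≤ β x) ∧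
    (a < b → β b ≤ α b → ∀ x ∈ Icc a b, α x = β x ∧
      dα x = pruferField r g x (α x) ∧ dβ x = pruferField r g x (β x)) := by
  rcases lt_or_ge b a with hba | hab
  · exact ⟨fun x hx => absurd (hx.1.trans hx.2) hba.not_ge, fun h => absurd h hba.not_gt⟩
  have hcα : ContinuousOn α (Icc a b) := fun x hx => (hα x hx).continuousWithinAt
  have hcβ : ContinuousOn β (Icc a b) := fun x hx => (hβ x hx).continuousWithinAt
  -- Integrating factor: (β - α) exp (-κ) has a nonnegative derivative, because only the defects of
  -- α and β remain in it.
  obtain ⟨κ, hκ⟩ := exists_antideriv (a := a) (b := b)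
    (k := fun x => r x * (g x - 1) * Real.sin (β x + α x) * Real.sinc (β x - α x)) (by
      refine ContinuousOn.mul (ContinuousOn.mul (by fun_prop) ?_) ?_
      · exact Real.continuous_sin.comp_continuousOn (hcβ.add hcα)
      · exact Real.continuous_sinc.comp_continuousOn (hcβ.sub hcα))
  have hD : ∀ x ∈ Icc a b, HasDerivWithinAt (fun x => (β x - α x) * Real.exp (-κ x))
      ((dβ x - dα x - (pruferField r g x (β x) - pruferField r g x (α x))) * Real.exp (-κ x))
      (Icc a b) x := fun x hx => by
    refine (((hβ x hx).fun_sub (hα x hx)).fun_mul (hκ x hx).fun_neg.exp).congr_deriv ?_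
    rw [pruferField_sub]
    ring
  have hmono : MonotoneOn (fun x => (β x - α x) * Real.exp (-κ x)) (Icc a b) := by
    refine monotoneOn_of_hasDerivWithinAt_nonneg (convex_Icc a b)
      (fun x hx => (hD x hx).continuousWithinAt)
      (fun x hx => (hD x (interior_subset hx)).mono interior_subset) (fun x hx => ?_)
    have hx' := interior_subset hx
    have := hsub x hx'
    have := hsup x hx'
    exact mul_nonneg (by linarith) (Real.exp_pos _).le
  have hle : ∀ x ∈ Icc a b, α x ≤ β x := fun x hx => by
    have h := hmono (left_mem_Icc.2 hab) hx hx.1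
    have h1 : 0 ≤ (β a - α a) * Real.exp (-κ a) := mul_nonneg (by linarith) (Real.exp_pos _).le
    have h2 := nonneg_of_mul_nonneg_left (h1.trans h) (Real.exp_pos _)
    linarith
  -- Equality at b squeezes a nonnegative monotone function to 0, so α = β, their derivatives agree
  -- and both defects vanish.
  refine ⟨hle, fun hlt hb x hx => ?_⟩
  have heq : ∀ x ∈ Icc a b, α x = β x := fun x hx => by
    refine le_antisymm (hle x hx) ?_
    have h := hmono hx (right_mem_Icc.2 hab) hx.2
    have h1 : (β b - α b) * Real.exp (-κ b) ≤ 0 :=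
      mul_nonpos_of_nonpos_of_nonneg (by linarith) (Real.exp_pos _).le
    have h2 := nonpos_of_mul_nonpos_left (h.trans h1) (Real.exp_pos _)
    linarith
  have hder : dα x = dβ x :=
    (uniqueDiffOn_Icc hlt x hx).eq_deriv _ (hα x hx)
      ((hβ x hx).congr (fun y hy => heq y hy) (heq x hx))
  have h1 := hsub x hx
  have h2 := hsup x hx
  rw [heq x hx] at h1 ⊢
  exact ⟨rfl, by linarith, by linarith⟩

theorem lipschitzWith_pruferField {r g : ℝ → ℝ} {x : ℝ} {C : NNReal}
    (hC : |r x| * (1 + |g x|) ≤ C) : LipschitzWith C (pruferField r g x) := by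
  refine LipschitzWith.of_dist_le_mul fun β α => ?_
  rw [Real.dist_eq, Real.dist_eq, pruferField_sub, abs_mul]
  refine mul_le_mul_of_nonneg_right (le_trans ?_ hC) (abs_nonneg _)
  rw [abs_mul, abs_mul, abs_mul]
  have h1 := Real.abs_sin_le_one (β + α)
  have h2 := Real.abs_sinc_le_one (β - α)
  have h3 : |g x - 1| ≤ 1 + |g x| := by
    have := abs_sub (g x) 1
    rw [abs_one] at this
    linarith
  calc |r x| * |g x - 1| * |Real.sin (β + α)| * |Real.sinc (β - α)|
      ≤ |r x| * |g x - 1| * 1 * 1 := by gcongr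
    _ ≤ |r x| * (1 + |g x|) := by rw [mul_one, mul_one]; gcongr

theorem abs_pruferField_le (r g : ℝ → ℝ) (x θ : ℝ) :
    |pruferField r g x θ| ≤ |r x| * (1 + |g x|) := by
  rw [pruferField, abs_mul]
  refine mul_le_mul_of_nonneg_left ?_ (abs_nonneg _)
  refine (abs_add_le _ _).trans (add_le_add ?_ ?_)
  · rw [abs_of_nonneg (sq_nonneg _)]; exact Real.cos_sq_le_one θ
  · rw [abs_mul, abs_of_nonneg (sq_nonneg (Real.sin θ))]
    exact mul_le_of_le_one_right (abs_nonneg _) (Real.sin_sq_le_one θ)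

theorem exists_pruferField_bound {r g : ℝ → ℝ} (hr : Continuous r) (hg : Continuous g) (a b : ℝ) :
    ∃ C : NNReal, ∀ x ∈ Icc a b, |r x| * (1 + |g x|) ≤ C := by
  obtain ⟨C, hC⟩ := (isCompact_Icc (a := a) (b := b)).bddAbove_image
    (f := fun x => |r x| * (1 + |g x|)) (by fun_prop)
  exact ⟨C.toNNReal, fun x hx =>
    (hC (mem_image_of_mem _ hx)).trans (Real.le_coe_toNNReal C)⟩

theorem exists_isPruferAngle {L : ℝ} (hL : 0 ≤ L) {r g : ℝ → ℝ} (hr : Continuous r)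
    (hg : Continuous g) (θ₀ : ℝ) : ∃ θ, θ 0 = θ₀ ∧ IsPruferAngle 0 L r g θ := by
  obtain ⟨C, hC⟩ := exists_pruferField_bound hr hg 0 L
  -- The field is bounded by C, so a solution cannot leave the ball of radius C L; hence existence
  -- on all of [0, L].
  have hPL : IsPicardLindelof (pruferField r g) (⟨0, left_mem_Icc.2 hL⟩ : Icc 0 L) θ₀
      (C * L.toNNReal) 0 C C :=
    { lipschitzOnWith := fun x hx => (lipschitzWith_pruferField (hC x hx)).lipschitzOnWith
      continuousOn := fun θ _ => by unfold pruferField; fun_prop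
      norm_le := fun x hx θ _ => (abs_pruferField_le r g x θ).trans (hC x hx)
      mul_max_le := by simp [hL] }
  exact hPL.exists_eq_forall_mem_Icc_hasDerivWithinAt₀

theorem continuous_pruferAngle_shift {L : ℝ} (hL : 0 ≤ L) {r g : ℝ → ℝ} (hr : Continuous r)
    (hg : Continuous g) {θ : ℝ → ℝ → ℝ} {θ₀ : ℝ} (h0 : ∀ μ, θ μ 0 = θ₀)
    (hθ : ∀ μ, IsPruferAngle 0 L r (fun x => g x + μ) (θ μ)) :
    Continuous fun μ => θ μ L := by
  rw [continuous_iff_continuousAt]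
  intro μ₀
  have hg' : Continuous fun x => g x + μ₀ := by fun_prop
  obtain ⟨C, hC⟩ := exists_pruferField_bound hr hg' 0 L
  have key : ∀ μ, dist (θ μ L) (θ μ₀ L) ≤ gronwallBound 0 C (C * |μ - μ₀|) L := fun μ => by
    -- Grönwall: θ μ solves the equation for μ₀ up to an error C |μ - μ₀|.
    have h := dist_le_of_approx_trajectories_ODE_of_mem (E := ℝ) (a := 0) (b := L) (K := C)
      (v := pruferField r fun x => g x + μ₀) (s := fun _ => univ) (f := θ μ) (g := θ μ₀)
      (f' := fun x => pruferField r (fun x => g x + μ) x (θ μ x))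
      (g' := fun x => pruferField r (fun x => g x + μ₀) x (θ μ₀ x))
      (εf := C * |μ - μ₀|) (εg := 0) (δ := 0)
      (fun x hx => (lipschitzWith_pruferField (hC x (Ico_subset_Icc_self hx))).lipschitzOnWith)
      (hθ μ).continuousOn
      (fun x hx => ((hθ μ) x (Ico_subset_Icc_self hx)).mono_of_mem_nhdsWithin
        (Icc_mem_nhdsGE_of_mem hx)) ?_ (fun _ _ => mem_univ _)
      (hθ μ₀).continuousOn
      (fun x hx => ((hθ μ₀) x (Ico_subset_Icc_self hx)).mono_of_mem_nhdsWithin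
        (Icc_mem_nhdsGE_of_mem hx)) (fun x _ => by simp) (fun _ _ => mem_univ _)
      (by simp [h0]) L (right_mem_Icc.2 hL)
    · simpa using h
    · intro x hx
      rw [Real.dist_eq]
      have : pruferField r (fun x => g x + μ) x (θ μ x)
          - pruferField r (fun x => g x + μ₀) x (θ μ x)
          = r x * (μ - μ₀) * Real.sin (θ μ x) ^ 2 := by unfold pruferField; ring
      rw [this, abs_mul, abs_mul, abs_of_nonneg (sq_nonneg (Real.sin _))]
      have h1 : |r x| ≤ C := le_trans (le_mul_of_one_le_right (abs_nonneg _)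
        (by linarith [abs_nonneg (g x + μ₀)])) (hC x (Ico_subset_Icc_self hx))
      calc |r x| * |μ - μ₀| * Real.sin (θ μ x) ^ 2 ≤ C * |μ - μ₀| * 1 := by
            gcongr; exact Real.sin_sq_le_one _
        _ = _ := mul_one _
  refine tendsto_iff_dist_tendsto_zero.2 (squeeze_zero (fun _ => dist_nonneg) key ?_)
  have hc : Continuous fun μ => gronwallBound 0 C (C * |μ - μ₀|) L :=
    (gronwallBound_continuous_ε 0 C L).comp (by fun_prop)
  have := hc.tendsto μ₀
  simpa [gronwallBound_ε0] using this

theorem pruferField_of_sin_eq_zero {r g : ℝ → ℝ} {x θ : ℝ} (h : Real.sin θ = 0) :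
    pruferField r g x θ = r x := by
  have : Real.cos θ ^ 2 = 1 := by rw [Real.cos_sq', h]; ring
  simp [pruferField, this, h]

/-- A Prüfer angle crosses the zeros of the sine upwards. -/
theorem IsPruferAngle.lt_of_le {a b : ℝ} (hab : a < b) {r g θ : ℝ → ℝ} (hr : Continuous r)
    (hr0 : ∀ x, 0 < r x) (hg : Continuous g) (h : IsPruferAngle a b r g θ) {φ : ℝ}
    (hφ : Real.sin φ = 0) (ha : φ ≤ θ a) : φ < θ b := by
  -- The constant φ is a subsolution since the field there equals r > 0; the equality case would
  -- force r b = 0.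
  have hc := prufer_comparison hr hg (α := fun _ => φ) (dα := fun _ => 0)
    (fun x _ => hasDerivWithinAt_const _ _ _) h
    (fun x _ => by rw [pruferField_of_sin_eq_zero hφ]; exact (hr0 x).le) (fun x _ => le_rfl) ha
  by_contra! hb
  have := (hc.2 hab hb b (right_mem_Icc.2 hab.le)).2.1
  rw [pruferField_of_sin_eq_zero hφ] at this
  exact (hr0 b).ne this

/-- At π/2 the field is r g ≤ 0, so the constant π/2 is a supersolution. -/
theorem IsPruferAngle.le_pi_div_two {L : ℝ} (hL : 0 ≤ L) {r g θ : ℝ → ℝ} (hr : Continuous r)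
    (hr0 : ∀ x, 0 < r x) (hg : Continuous g) (h : IsPruferAngle 0 L r g θ)
    (hg0 : ∀ x ∈ Icc 0 L, g x ≤ 0) (h0 : θ 0 ≤ Real.pi / 2) : θ L ≤ Real.pi / 2 := by
  refine (prufer_comparison hr hg (β := fun _ => Real.pi / 2) (dβ := fun _ => 0) h
    (fun x _ => hasDerivWithinAt_const _ _ _) (fun x _ => le_rfl) (fun x hx => ?_) h0).1 L
    (right_mem_Icc.2 hL)
  simpa [pruferField] using mul_nonpos_of_nonneg_of_nonpos (hr0 x).le (hg0 x hx)

/-- Equality at L would force (g' - g) sin² θ = 0, hence sin θ = 0 on the open interval; but θ' = r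
> 0 wherever the sine vanishes. Strictness is asked only in the interior because coupled potentials
may agree at L. -/
theorem IsPruferAngle.lt_of_potential_lt {L : ℝ} (hL : 0 < L) {r g g' θ θ' : ℝ → ℝ}
    (hr : Continuous r) (hr0 : ∀ x, 0 < r x) (hg' : Continuous g')
    (h : IsPruferAngle 0 L r g θ) (h' : IsPruferAngle 0 L r g' θ')
    (hgg : ∀ x ∈ Icc 0 L, g x ≤ g' x) (hlt : ∀ x ∈ Ioo 0 L, g x < g' x)
    (h0 : θ 0 ≤ θ' 0) : θ L < θ' L := by
  have hc := prufer_comparison hr hg' h h' (fun x hx => by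
    have := hgg x hx
    have := (hr0 x).le
    unfold pruferField
    gcongr) (fun x _ => le_rfl) h0
  by_contra! hb
  have hs : ∀ x ∈ Ioo 0 L, Real.sin (θ x) = 0 := fun x hx => by
    have h1 := (hc.2 hL hb x (Ioo_subset_Icc_self hx)).2.1
    unfold pruferField at h1
    have h2 := mul_left_cancel₀ (hr0 x).ne' h1
    have h3 : (g' x - g x) * Real.sin (θ x) ^ 2 = 0 := by linarith
    have := hlt x hx
    rcases mul_eq_zero.1 h3 with h4 | h4
    · linarith
    · exact pow_eq_zero_iff two_ne_zero |>.1 h4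
  have hx : L / 2 ∈ Ioo 0 L := ⟨by linarith, by linarith⟩
  have hd := ((h _ (Ioo_subset_Icc_self hx)).hasDerivAt (Icc_mem_nhds hx.1 hx.2)).sin
  have hz : HasDerivAt (fun x => Real.sin (θ x)) 0 (L / 2) :=
    (hasDerivAt_const _ (0 : ℝ)).congr_of_eventuallyEq
      (Filter.eventuallyEq_of_mem (Ioo_mem_nhds hx.1 hx.2) hs)
  have he := hd.unique hz
  rw [pruferField_of_sin_eq_zero (hs _ hx)] at he
  rcases mul_eq_zero.1 he with h4 | h4
  · have := Real.sin_sq_add_cos_sq (θ (L / 2))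
    rw [hs _ hx, h4] at this
    norm_num at this
  · exact (hr0 _).ne' h4

/-! ### Steering the end angle by the size of the potential. -/

/-- The integral is the time in which θ' = cos² θ + G sin² θ moves from 0 to T. It tends to 0 as G
grows, by dominated convergence: the integrand is at most 1 for G ≥ 1 and tends to 0 off the
countable zero set of the sine. -/
theorem exists_integral_inv_lt (T : ℝ) {ε : ℝ} (hε : 0 < ε) :
    ∃ G : ℝ, 1 ≤ G ∧ ∫ u in (0 : ℝ)..T, 1 / (Real.cos u ^ 2 + G * Real.sin u ^ 2) < ε := by
  have hlim : Filter.Tendsto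
      (fun G : ℝ => ∫ u in (0 : ℝ)..T, 1 / (Real.cos u ^ 2 + G * Real.sin u ^ 2))
      Filter.atTop (nhds (∫ u in (0 : ℝ)..T, (0 : ℝ))) := by
    refine intervalIntegral.tendsto_integral_filter_of_dominated_convergence (fun _ => 1)
      ?_ ?_ (by simp) ?_
    · refine .of_forall fun G => Measurable.aestronglyMeasurable (by fun_prop)
    · filter_upwards [Filter.eventually_ge_atTop 1] with G hG
      refine .of_forall fun u _ => ?_
      have h1 : 1 ≤ Real.cos u ^ 2 + G * Real.sin u ^ 2 := by
        nlinarith [Real.sin_sq_add_cos_sq u, sq_nonneg (Real.sin u)]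
      rw [Real.norm_eq_abs, abs_of_nonneg (by positivity)]
      exact div_le_one_of_le₀ h1 (by linarith)
    · have hcount : {u : ℝ | Real.sin u = 0}.Countable := by
        refine (countable_range fun n : ℤ => (n : ℝ) * Real.pi).mono fun u hu => ?_
        exact Real.sin_eq_zero_iff.1 hu
      filter_upwards [hcount.ae_notMem MeasureTheory.volume] with u hu _
      have hs : 0 < Real.sin u ^ 2 := by
        have : Real.sin u ≠ 0 := hu
        positivity
      simp only [one_div]
      exact (Filter.tendsto_atTop_add_const_left _ _
        (Filter.tendsto_id.atTop_mul_const hs)).inv_tendsto_atTop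
  rw [intervalIntegral.integral_zero] at hlim
  obtain ⟨G, h1, h2⟩ := ((hlim.eventually_lt_const hε).and (Filter.eventually_ge_atTop 1)).exists
  exact ⟨G, h2, h1⟩

/-- If the potential is large on an initial interval, the Prüfer angle becomes large. -/
theorem exists_le_pruferAngle (T : ℝ) {r₀ l : ℝ} (hr₀ : 0 < r₀) (hl : 0 < l) :
    ∃ G : ℝ, 0 ≤ G ∧ ∀ (L : ℝ) (r g θ : ℝ → ℝ), l ≤ L → Continuous r → Continuous g →
      (∀ x, r₀ ≤ r x) → (∀ x ∈ Icc 0 l, G ≤ g x) → (∀ x ∈ Icc 0 L, 0 ≤ g x) →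
      IsPruferAngle 0 L r g θ → 0 ≤ θ 0 → T ≤ θ L := by
  obtain ⟨G, hG, hlt⟩ := exists_integral_inv_lt T (mul_pos hr₀ hl)
  refine ⟨G, by linarith, fun L r g θ hlL hr hg hrr hgl hgL hθ h0 => ?_⟩
  have hE : ∀ u : ℝ, 0 < Real.cos u ^ 2 + G * Real.sin u ^ 2 := fun u => by
    nlinarith [Real.sin_sq_add_cos_sq u, sq_nonneg (Real.sin u)]
  have hcont : Continuous fun u : ℝ => 1 / (Real.cos u ^ 2 + G * Real.sin u ^ 2) :=
    continuous_const.div (by fun_prop) fun u => (hE u).ne'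
  set Φ : ℝ → ℝ := fun y => ∫ u in (0 : ℝ)..y, 1 / (Real.cos u ^ 2 + G * Real.sin u ^ 2)
  have hΦ : ∀ y, HasDerivAt Φ (1 / (Real.cos y ^ 2 + G * Real.sin y ^ 2)) y := fun y =>
    intervalIntegral.integral_hasDerivAt_right (hcont.intervalIntegrable _ _)
      (hcont.stronglyMeasurableAtFilter _ _) hcont.continuousAt
  have hΦm : Monotone Φ := monotone_of_hasDerivAt_nonneg hΦ fun y => (one_div_pos.2 (hE y)).le
  -- Beyond l a nonnegative potential keeps the angle nondecreasing, so it suffices to reach T by l.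
  have hθm : θ l ≤ θ L := by
    have hm : MonotoneOn θ (Icc 0 L) := monotoneOn_of_hasDerivWithinAt_nonneg (convex_Icc _ _)
      hθ.continuousOn (fun x hx => (hθ x (interior_subset hx)).mono interior_subset)
      fun x hx => mul_nonneg (hr₀.le.trans (hrr x)) (add_nonneg (sq_nonneg _)
        (mul_nonneg (hgL x (interior_subset hx)) (sq_nonneg _)))
    exact hm ⟨hl.le, hlL⟩ ⟨hl.le.trans hlL, le_rfl⟩ hlL
  by_contra! hT
  have hθl := hθ.mono le_rfl hlL
  have hD : ∀ x ∈ Icc 0 l, HasDerivWithinAt (fun x => Φ (θ x) - r₀ * x)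
      (1 / (Real.cos (θ x) ^ 2 + G * Real.sin (θ x) ^ 2) * pruferField r g x (θ x) - r₀ * 1)
      (Icc 0 l) x := fun x hx =>
    ((hΦ (θ x)).comp_hasDerivWithinAt x (hθl x hx)).sub ((hasDerivWithinAt_id x _).const_mul r₀)
  -- Φ is the travel time of the model equation, so Φ ∘ θ grows at rate at least r₀; over [0, l] it
  -- gains r₀ l, more than Φ T allows.
  have hm : MonotoneOn (fun x => Φ (θ x) - r₀ * x) (Icc 0 l) :=
    monotoneOn_of_hasDerivWithinAt_nonneg (convex_Icc _ _)
      (fun x hx => (hD x hx).continuousWithinAt)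
      (fun x hx => (hD x (interior_subset hx)).mono interior_subset) fun x hx => by
        have hx' := interior_subset hx
        have h1 : r₀ * (Real.cos (θ x) ^ 2 + G * Real.sin (θ x) ^ 2) ≤
            pruferField r g x (θ x) := by
          unfold pruferField
          have := hgl x hx'
          have := hE (θ x)
          have := hrr x
          gcongr
          linarith
        rw [mul_one, sub_nonneg, one_div, inv_mul_eq_div, le_div_iff₀ (hE _)]
        exact h1
  have h1 := hm (left_mem_Icc.2 hl.le) (right_mem_Icc.2 hl.le) hl.le
  have h2 : Φ 0 ≤ Φ (θ 0) := hΦm h0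
  have h3 : Φ (θ l) ≤ Φ T := hΦm (hθm.trans hT.le)
  have h4 : Φ 0 = 0 := intervalIntegral.integral_same
  have h5 : Φ T < r₀ * l := hlt
  simp only [mul_zero, sub_zero] at h1
  linarith

/-- A shift of the potential steers the Prüfer angle at the right end to a given value. -/
theorem exists_shift_pruferAngle_eq {L : ℝ} (hL : 0 < L) {r g : ℝ → ℝ} (hr : Continuous r)
    {r₀ : ℝ} (hr₀ : 0 < r₀) (hrr : ∀ x, r₀ ≤ r x) (hg : Continuous g) {θ₀ T : ℝ} (h0 : 0 ≤ θ₀)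
    (h0' : θ₀ ≤ Real.pi / 2) (hT : Real.pi / 2 ≤ T) :
    ∃ (μ : ℝ) (θ : ℝ → ℝ), IsPruferAngle 0 L r (fun x => g x + μ) θ ∧ θ 0 = θ₀ ∧ θ L = T := by
  have hc : ∀ μ, Continuous fun x => g x + μ := fun μ => by fun_prop
  choose θ hθ0 hθ using fun μ => exists_isPruferAngle hL.le hr (hc μ) θ₀
  have hcont := continuous_pruferAngle_shift hL.le hr hg hθ0 hθ
  obtain ⟨G, hG0, hG⟩ := exists_le_pruferAngle T hr₀ hL
  obtain ⟨M, hM⟩ := (isCompact_Icc (a := 0) (b := L)).bddAbove_image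
    (f := fun x => |g x|) (by fun_prop)
  have hM' : ∀ x ∈ Icc 0 L, |g x| ≤ M := fun x hx => hM (mem_image_of_mem _ hx)
  -- The shift -M makes the potential nonpositive and keeps the angle below π/2 ≤ T; the shift M + G
  -- makes it at least G everywhere.
  have hlow : θ (-M) L ≤ T := by
    refine le_trans ?_ hT
    refine (hθ (-M)).le_pi_div_two hL.le hr (fun x => hr₀.trans_le (hrr x)) (hc _)
      (fun x hx => ?_) ((hθ0 _).trans_le h0')
    have := hM' x hx
    have := le_abs_self (g x)
    linarith
  have hbig : ∀ x ∈ Icc 0 L, G ≤ g x + (M + G) := fun x hx => by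
    have := hM' x hx
    have := neg_abs_le (g x)
    linarith
  have hhigh : T ≤ θ (M + G) L := hG L r _ _ le_rfl hr (hc _) hrr hbig
    (fun x hx => hG0.trans (hbig x hx)) (hθ _) (by rw [hθ0]; exact h0)
  obtain ⟨μ, hμ⟩ := mem_range_of_exists_le_of_exists_ge hcont ⟨_, hlow⟩ ⟨_, hhigh⟩
  exact ⟨μ, θ μ, hθ μ, hθ0 μ, hμ⟩

/-! ### Eigenfunctions with j zeros as boundary values of the Prüfer angle. -/

/-- The Prüfer angle at the left end for the boundary condition of parity `κ`. -/
noncomputable def startAngle (κ : Fin 2) : ℝ := if κ = 0 then Real.pi / 2 else 0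

/-- The Prüfer angle at the right end, for the boundary condition of parity `κ`, of a solution
with `j` zeros in the interior. -/
noncomputable def targetAngle (κ : Fin 2) (j : ℕ) : ℝ :=
  j * Real.pi + if κ = 0 then Real.pi / 2 else Real.pi

theorem startAngle_nonneg (κ : Fin 2) : 0 ≤ startAngle κ := by
  have := Real.pi_pos
  unfold startAngle
  split_ifs <;> positivity

theorem startAngle_le (κ : Fin 2) : startAngle κ ≤ Real.pi / 2 := by
  have := Real.pi_pos
  unfold startAngle
  split_ifs <;> linarith

theorem pi_div_two_le_targetAngle (κ : Fin 2) (j : ℕ) : Real.pi / 2 ≤ targetAngle κ j := by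
  have := Real.pi_pos
  have : 0 ≤ (j : ℝ) * Real.pi := by positivity
  unfold targetAngle
  split_ifs <;> linarith

theorem targetAngle_le_one (κ : Fin 2) (j : ℕ) : targetAngle κ j ≤ targetAngle 1 j := by
  have := Real.pi_pos
  unfold targetAngle
  split_ifs <;> simp_all
  linarith

/-- The source of the index shift in the lower bound for κ₂ = 0. -/
theorem targetAngle_one_lt (j : ℕ) : targetAngle 1 j < targetAngle 0 (j + 1) := by
  have := Real.pi_pos
  simp only [targetAngle]
  push_cast
  linarith

theorem sin_targetAngle_one (j : ℕ) : Real.sin (targetAngle 1 j) = 0 := by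
  have : targetAngle 1 j = ((j + 1 : ℕ) : ℝ) * Real.pi := by
    simp only [targetAngle]; push_cast; ring
  rw [this, Real.sin_nat_mul_pi]

/-- The angle crosses multiples of π only upwards, hence each at most once; those crossed in the
interior are exactly π, …, jπ. -/
theorem encard_zeros_of_pruferAngle {L : ℝ} (hL : 0 < L) {r g θ : ℝ → ℝ} (hr : Continuous r)
    (hr0 : ∀ x, 0 < r x) (hg : Continuous g) (h : IsPruferAngle 0 L r g θ) {κ₀ κL : Fin 2} {j : ℕ}
    (h0 : θ 0 = startAngle κ₀) (h1 : θ L = targetAngle κL j) :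
    {x ∈ Ioo 0 L | Real.sin (θ x) = 0}.encard = j := by
  have hpi := Real.pi_pos
  have hlt : ∀ x ∈ Icc 0 L, ∀ y ∈ Icc 0 L, x < y → Real.sin (θ x) = 0 → θ x < θ y :=
    fun x hx y hy hxy hs => (h.mono hx.1 hy.2).lt_of_le hxy hr hr0 hg hs le_rfl
  have hinj : InjOn θ {x ∈ Ioo 0 L | Real.sin (θ x) = 0} := fun x hx y hy hxy => by
    by_contra hne
    rcases lt_or_gt_of_ne hne with h2 | h2
    · exact (hlt x (Ioo_subset_Icc_self hx.1) y (Ioo_subset_Icc_self hy.1) h2 hx.2).ne hxy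
    · exact (hlt y (Ioo_subset_Icc_self hy.1) x (Ioo_subset_Icc_self hx.1) h2 hy.2).ne' hxy
  have himg : θ '' {x ∈ Ioo 0 L | Real.sin (θ x) = 0} =
      (fun i : ℕ => ((i : ℝ) + 1) * Real.pi) '' (Finset.range j : Set ℕ) := by
    ext y
    constructor
    · rintro ⟨x, ⟨hx, hs⟩, rfl⟩
      obtain ⟨n, hn⟩ := Real.sin_eq_zero_iff.1 hs
      have hpos : 0 < θ x := (h.mono le_rfl hx.2.le).lt_of_le hx.1 hr hr0 hg Real.sin_zero
        (by rw [h0]; exact startAngle_nonneg κ₀)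
      have hup : θ x < θ L :=
        hlt x (Ioo_subset_Icc_self hx) L (right_mem_Icc.2 hL.le) hx.2 hs
      rw [h1] at hup
      have hup' := hup.trans_le (targetAngle_le_one κL j)
      rw [← hn] at hpos hup'
      have hn0 : 0 < n := by
        have := pos_of_mul_pos_left hpos hpi.le
        exact_mod_cast this
      have hnj : n < j + 1 := by
        have : (n : ℝ) * Real.pi < ((j : ℝ) + 1) * Real.pi := by
          simp only [targetAngle] at hup'
          norm_num at hup'
          linarith
        have := lt_of_mul_lt_mul_right this hpi.le
        exact_mod_cast this
      refine ⟨(n - 1).toNat, ?_, ?_⟩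
      · simp only [Finset.coe_range, mem_Iio]; omega
      · have : (((n - 1).toNat : ℤ) : ℝ) = ((n - 1 : ℤ) : ℝ) := by
          rw [Int.toNat_of_nonneg (by omega)]
        simp only [Int.cast_natCast] at this
        simp only [this, ← hn]
        push_cast
        ring
    · rintro ⟨i, hi, rfl⟩
      simp only [Finset.coe_range, mem_Iio] at hi
      have hi' : (i : ℝ) + 1 ≤ j := by exact_mod_cast hi
      have h3 : θ 0 < ((i : ℝ) + 1) * Real.pi := by
        rw [h0]
        have := startAngle_le κ₀
        nlinarith [(Nat.cast_nonneg i : (0 : ℝ) ≤ i)]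
      have h4 : ((i : ℝ) + 1) * Real.pi < θ L := by
        rw [h1]
        have : ((i : ℝ) + 1) * Real.pi ≤ j * Real.pi := by gcongr
        unfold targetAngle
        split_ifs <;> linarith
      obtain ⟨x, hx, hxe⟩ := intermediate_value_Ioo hL.le h.continuousOn ⟨h3, h4⟩
      refine ⟨x, ⟨hx, ?_⟩, hxe⟩
      rw [hxe]
      exact_mod_cast Real.sin_nat_mul_pi (i + 1)
  rw [← hinj.encard_image, himg, Function.Injective.encard_image, encard_coe_eq_coe_finsetCard,
    Finset.card_range]
  intro i i' hii
  have := mul_right_cancel₀ hpi.ne' hii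
  exact_mod_cast add_right_cancel this

theorem exists_targetAngle_of_pos {κ : Fin 2} {φ : ℝ} (h0 : 0 < φ)
    (h : if κ = 0 then Real.cos φ = 0 else Real.sin φ = 0) : ∃ j, φ = targetAngle κ j := by
  have hpi := Real.pi_pos
  unfold targetAngle
  split_ifs at h ⊢ with hκ
  · obtain ⟨n, hn⟩ := Real.cos_eq_zero_iff.1 h
    rw [hn] at h0
    have hn0 : 0 ≤ n := by
      have h1 : (0 : ℝ) < 2 * n + 1 := by
        by_contra! hle
        nlinarith
      have h2 : (0 : ℤ) < 2 * n + 1 := by exact_mod_cast h1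
      omega
    lift n to ℕ using hn0
    exact ⟨n, by rw [hn]; push_cast; ring⟩
  · obtain ⟨n, hn⟩ := Real.sin_eq_zero_iff.1 h
    rw [← hn] at h0
    have hn0 : 0 < n := by
      have := pos_of_mul_pos_left h0 hpi.le
      exact_mod_cast this
    obtain ⟨i, rfl⟩ : ∃ i : ℕ, n = i + 1 := ⟨(n - 1).toNat, by omega⟩
    exact ⟨i, by rw [← hn]; push_cast; ring⟩

/-- A solution satisfying the left boundary condition is `y = ρ sin θ`, `y' / r = ρ cos θ` with a
nowhere vanishing `ρ`. -/
theorem IsSLSolution.exists_polar {L : ℝ} {r g θ y dy : ℝ → ℝ} (hr : Continuous r)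
    (hr0 : ∀ x, 0 < r x) (hg : Continuous g) (h : IsPruferAngle 0 L r g θ)
    (hy : IsSLSolution L r g y dy) (hne : ∃ x ∈ Icc 0 L, y x ≠ 0) {κ₀ : Fin 2}
    (h0 : θ 0 = startAngle κ₀) (hbc : ParityBC κ₀ y dy 0) :
    ∃ ρ : ℝ → ℝ, ∀ x ∈ Icc 0 L, ρ x ≠ 0 ∧ y x = ρ x * Real.sin (θ x) ∧
      1 / r x * dy x = ρ x * Real.cos (θ x) := by
  set z : ℝ → ℝ := fun ξ => 1 / r ξ * dy ξ with hz
  have hdy : ∀ x, dy x = r x * z x := fun x => by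
    have := (hr0 x).ne'
    simp only [hz]
    field_simp
  have hk : ContinuousOn (fun x => r x * (1 - g x) * Real.sin (θ x) * Real.cos (θ x))
      (Icc 0 L) := by
    have := h.continuousOn
    fun_prop
  have hyd : ∀ x ∈ Icc 0 L, HasDerivWithinAt y (r x * z x) (Icc 0 L) x := fun x hx => by
    rw [← hdy]; exact hy.hasDeriv x hx
  have hW : ∀ x ∈ Icc 0 L, HasDerivWithinAt
      (fun x => y x * Real.cos (θ x) - z x * Real.sin (θ x))
      (-(r x * (1 - g x) * Real.sin (θ x) * Real.cos (θ x)) *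
        (y x * Real.cos (θ x) - z x * Real.sin (θ x))) (Icc 0 L) x := fun x hx => by
    refine (((hyd x hx).fun_mul (h x hx).cos).fun_sub
      ((hy.equation x hx).fun_mul (h x hx).sin)).congr_deriv ?_
    unfold pruferField
    linear_combination -(r x * z x * Real.cos (θ x) + r x * g x * y x * Real.sin (θ x)) *
      Real.sin_sq_add_cos_sq (θ x)
  obtain ⟨κ, hκ⟩ := eq_mul_exp_of_linear hk.neg hW
  have hW0 : y 0 * Real.cos (θ 0) - z 0 * Real.sin (θ 0) = 0 := by
    rw [h0]
    unfold ParityBC at hbc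
    unfold startAngle
    split_ifs at hbc ⊢ with h3
    · simp [hz, hbc]
    · simp [hbc]
  have hWz : ∀ x ∈ Icc 0 L, y x * Real.cos (θ x) - z x * Real.sin (θ x) = 0 := fun x hx => by
    rw [hκ x hx, hW0, zero_mul]
  have hR : ∀ x ∈ Icc 0 L, HasDerivWithinAt
      (fun x => y x * Real.sin (θ x) + z x * Real.cos (θ x))
      ((r x * (1 - g x) * Real.sin (θ x) * Real.cos (θ x)) *
        (y x * Real.sin (θ x) + z x * Real.cos (θ x))) (Icc 0 L) x := fun x hx => by
    refine (((hyd x hx).fun_mul (h x hx).sin).fun_add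
      ((hy.equation x hx).fun_mul (h x hx).cos)).congr_deriv ?_
    unfold pruferField
    linear_combination
      (r x * (Real.cos (θ x) ^ 2 + g x * Real.sin (θ x) ^ 2)
        - r x * (Real.sin (θ x) ^ 2 + g x * Real.cos (θ x) ^ 2)) * hWz x hx
      - (r x * z x * Real.sin (θ x) - r x * g x * y x * Real.cos (θ x)) *
        Real.sin_sq_add_cos_sq (θ x)
  obtain ⟨κ', hκ'⟩ := eq_mul_exp_of_linear hk hR
  have hy' : ∀ x ∈ Icc 0 L,
      y x = (y x * Real.sin (θ x) + z x * Real.cos (θ x)) * Real.sin (θ x) := fun x hx => by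
    linear_combination Real.cos (θ x) * hWz x hx - y x * Real.sin_sq_add_cos_sq (θ x)
  have hz' : ∀ x ∈ Icc 0 L,
      z x = (y x * Real.sin (θ x) + z x * Real.cos (θ x)) * Real.cos (θ x) := fun x hx => by
    linear_combination -Real.sin (θ x) * hWz x hx - z x * Real.sin_sq_add_cos_sq (θ x)
  obtain ⟨x₁, hx₁, hne⟩ := hne
  refine ⟨_, fun x hx => ⟨fun hρ => hne ?_, hy' x hx, hz' x hx⟩⟩
  have h1 := hκ' x hx
  rw [hρ] at h1
  rw [hy' x₁ hx₁, hκ' x₁ hx₁, (mul_eq_zero.1 h1.symm).resolve_right (Real.exp_pos _).ne']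
  ring

/-- The radius must satisfy ρ'/ρ = r (1 - g) sin θ cos θ, so the exponential of a primitive serves.
-/
theorem IsPruferAngle.exists_solution {L : ℝ} {r g θ : ℝ → ℝ} (hr : Continuous r)
    (hr0 : ∀ x, 0 < r x) (hg : Continuous g) (h : IsPruferAngle 0 L r g θ) :
    ∃ ρ : ℝ → ℝ, (∀ x, 0 < ρ x) ∧
      IsSLSolution L r g (fun x => ρ x * Real.sin (θ x)) fun x => r x * (ρ x * Real.cos (θ x)) := by
  obtain ⟨κ, hκ⟩ := exists_antideriv (a := 0) (b := L)
    (k := fun x => r x * (1 - g x) * Real.sin (θ x) * Real.cos (θ x)) (by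
      have := h.continuousOn
      fun_prop)
  refine ⟨fun x => Real.exp (κ x), fun x => Real.exp_pos _, ⟨fun x hx => ?_, fun x hx => ?_⟩⟩
  · refine ((hκ x hx).exp.fun_mul (h x hx).sin).congr_deriv ?_
    unfold pruferField
    linear_combination (r x * Real.cos (θ x) * Real.exp (κ x)) * Real.sin_sq_add_cos_sq (θ x)
  · have heq : (fun ξ => 1 / r ξ * (r ξ * (Real.exp (κ ξ) * Real.cos (θ ξ)))) =
        fun ξ => Real.exp (κ ξ) * Real.cos (θ ξ) := funext fun ξ => by
      have := (hr0 ξ).ne'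
      field_simp
    rw [heq]
    refine ((hκ x hx).exp.fun_mul (h x hx).cos).congr_deriv ?_
    unfold pruferField
    linear_combination
      -(r x * g x * Real.exp (κ x) * Real.sin (θ x)) * Real.sin_sq_add_cos_sq (θ x)

/-- Eigenfunctions with `j` interior zeros correspond to Prüfer angles with prescribed boundary
values. -/
theorem hasEigenfunction_iff {L : ℝ} (hL : 0 < L) {r g : ℝ → ℝ} (hr : Continuous r)
    (hr0 : ∀ x, 0 < r x) (hg : Continuous g) {κ₀ κL : Fin 2} {j : ℕ} :
    HasEigenfunction L r g κ₀ κL j ↔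
      ∃ θ, IsPruferAngle 0 L r g θ ∧ θ 0 = startAngle κ₀ ∧ θ L = targetAngle κL j := by
  have h0L := left_mem_Icc.2 hL.le
  have hLL := right_mem_Icc.2 hL.le
  constructor
  · rintro ⟨y, dy, hy, hne, hbc0, hbcL, hcard⟩
    obtain ⟨θ, hθ0, hθ⟩ := exists_isPruferAngle hL.le hr hg (startAngle κ₀)
    obtain ⟨ρ, hρ⟩ := hy.exists_polar hr hr0 hg hθ hne hθ0 hbc0
    have hpos : 0 < θ L := hθ.lt_of_le hL hr hr0 hg Real.sin_zero
      (by rw [hθ0]; exact startAngle_nonneg κ₀)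
    -- The right boundary condition leaves only the target angles; counting zeros then identifies i
    -- with j.
    obtain ⟨i, hi⟩ := exists_targetAngle_of_pos (κ := κL) hpos (by
      obtain ⟨h1, h2, h3⟩ := hρ L hLL
      unfold ParityBC at hbcL
      split_ifs at hbcL ⊢
      · rw [hbcL, mul_zero] at h3
        exact (mul_eq_zero.1 h3.symm).resolve_left h1
      · rw [hbcL] at h2
        exact (mul_eq_zero.1 h2.symm).resolve_left h1)
    refine ⟨θ, hθ, hθ0, ?_⟩
    have hset : {x ∈ Ioo 0 L | y x = 0} = {x ∈ Ioo 0 L | Real.sin (θ x) = 0} := by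
      ext x
      refine and_congr_right fun hx => ?_
      obtain ⟨h1, h2, -⟩ := hρ x (Ioo_subset_Icc_self hx)
      rw [h2, mul_eq_zero, or_iff_right h1]
    rw [hset, encard_zeros_of_pruferAngle hL hr hr0 hg hθ hθ0 hi] at hcard
    have : i = j := by exact_mod_cast hcard
    rw [hi, this]
  · rintro ⟨θ, hθ, hθ0, hθL⟩
    obtain ⟨ρ, hρ, hsol⟩ := hθ.exists_solution hr hr0 hg
    have hpi := Real.pi_pos
    refine ⟨_, _, hsol, ?_, ?_, ?_, ?_⟩
    · by_contra! hall
      have hs : ∀ x ∈ Icc 0 L, Real.sin (θ x) = 0 := fun x hx =>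
        (mul_eq_zero.1 (hall x hx)).resolve_left (hρ x).ne'
      have hset : {x ∈ Ioo 0 L | Real.sin (θ x) = 0} = Ioo 0 L :=
        sep_eq_self_iff_mem_true.2 fun x hx => hs x (Ioo_subset_Icc_self hx)
      have hcard := encard_zeros_of_pruferAngle hL hr hr0 hg hθ hθ0 hθL
      rw [hset, (Ioo_infinite hL).encard_eq] at hcard
      exact ENat.top_ne_natCast j hcard
    · unfold ParityBC
      unfold startAngle at hθ0
      split_ifs at hθ0 ⊢ <;> simp [hθ0]
    · unfold ParityBC
      split_ifs with hκ
      · have : Real.cos (θ L) = 0 := by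
          rw [hθL, hκ, Real.cos_eq_zero_iff]
          exact ⟨j, by simp [targetAngle]; ring⟩
        simp [this]
      · have : κL = 1 := by omega
        simp only [hθL, this, sin_targetAngle_one, mul_zero]
    · rw [← encard_zeros_of_pruferAngle hL hr hr0 hg hθ hθ0 hθL]
      congr 1
      ext x
      refine and_congr_right fun hx => ?_
      rw [mul_eq_zero, or_iff_right (hρ x).ne']

/-- For a nonincreasing potential and a Dirichlet condition at the right end the Prüfer angle is
nondecreasing. -/
theorem IsPruferAngle.energy_nonneg {a b : ℝ} {r g θ : ℝ → ℝ} (hr : Continuous r)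
    (hr0 : ∀ x, 0 < r x) (hg : Continuous g) (hanti : AntitoneOn g (Icc a b))
    (h : IsPruferAngle a b r g θ) (hb : Real.sin (θ b) = 0) {x : ℝ} (hx : x ∈ Icc a b) :
    0 ≤ Real.cos (θ x) ^ 2 + g x * Real.sin (θ x) ^ 2 := by
  by_contra! hE
  have hs : Real.sin (θ x) ≠ 0 := fun hs => by
    rw [hs] at hE
    nlinarith [sq_nonneg (Real.cos (θ x))]
  have hxb : x < b := lt_of_le_of_ne hx.2 fun hxb => hs (hxb ▸ hb)
  have hpi := Real.pi_pos
  set i := ⌊θ x / Real.pi⌋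
  have h1 : (i : ℝ) * Real.pi ≤ θ x := (le_div_iff₀ hpi).1 (Int.floor_le _)
  have h2 : θ x < (i + 1 : ℝ) * Real.pi := (div_lt_iff₀ hpi).1 (Int.lt_floor_add_one _)
  have hθx := h.mono hx.1 le_rfl
  have h3 : (i : ℝ) * Real.pi < θ b := hθx.lt_of_le hxb hr hr0 hg (Real.sin_int_mul_pi i) h1
  -- With negative energy at x and g nonincreasing, the constant θ x is a supersolution on [x, b].
  -- So θ b lies strictly between iπ and (i + 1)π, contradicting sin (θ b) = 0.
  have hle : θ b ≤ θ x := (prufer_comparison hr hg (β := fun _ => θ x) (dβ := fun _ => 0) hθx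
    (fun y _ => hasDerivWithinAt_const _ _ _) (fun y _ => le_rfl) (fun y hy => by
      have hgy : g y ≤ g x := hanti hx ⟨hx.1.trans hy.1, hy.2⟩ hy.1
      refine mul_nonpos_of_nonneg_of_nonpos (hr0 y).le ?_
      nlinarith [sq_nonneg (Real.sin (θ x))]) le_rfl).1 b (right_mem_Icc.2 hxb.le)
  obtain ⟨n, hn⟩ := Real.sin_eq_zero_iff.1 hb
  rw [← hn] at h3 hle
  have h4 := lt_of_mul_lt_mul_right h3 hpi.le
  have h5 := lt_of_mul_lt_mul_right (hle.trans_lt h2) hpi.le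
  have h6 : i < n := by exact_mod_cast h4
  have h7 : n < i + 1 := by exact_mod_cast h5
  omega

/-! ### Calculus of the Jacobi functions on [0, K]. -/

section Jacobi

variable {k : ℝ}

theorem ellipticF_zero (k : ℝ) : ellipticF k 0 = 0 := by simp [ellipticF]

theorem ellipticF_jacobiAm (hk : k ^ 2 < 1) (u : ℝ) : ellipticF k (jacobiAm u k) = u :=
  Function.invFun_eq ((ellipticF_bijective hk).surjective u)

theorem jacobiAm_ellipticF (hk : k ^ 2 < 1) (φ : ℝ) : jacobiAm (ellipticF k φ) k = φ :=
  Function.leftInverse_invFun (ellipticF_bijective hk).injective φ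

theorem jacobiAm_zero (hk : k ^ 2 < 1) : jacobiAm 0 k = 0 := by
  simpa [ellipticF_zero] using jacobiAm_ellipticF hk 0

theorem jacobiAm_ellipticK (hk : k ^ 2 < 1) : jacobiAm (ellipticK k) k = Real.pi / 2 :=
  jacobiAm_ellipticF hk _

theorem strictMono_ellipticF (hk : k ^ 2 < 1) : StrictMono (ellipticF k) := fun x y hxy => by
  linarith [sub_le_ellipticF_sub hk hxy.le]

theorem strictMono_jacobiAm (hk : k ^ 2 < 1) : StrictMono fun u => jacobiAm u k :=
  fun u v huv => (strictMono_ellipticF hk).lt_iff_lt.1 (by simpa [ellipticF_jacobiAm hk] using huv)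

theorem ellipticK_pos (hk : k ^ 2 < 1) : 0 < ellipticK k := by
  rw [← ellipticF_zero k]
  exact strictMono_ellipticF hk (by linarith [Real.pi_pos])

/-- F(·, k) does not contract distances, so its inverse is 1-Lipschitz. -/
theorem continuous_jacobiAm (hk : k ^ 2 < 1) : Continuous fun u => jacobiAm u k := by
  refine (LipschitzWith.of_le_add (f := fun u => jacobiAm u k) fun u v => ?_).continuous
  rcases le_total v u with h | h
  · have h1 := sub_le_ellipticF_sub hk ((strictMono_jacobiAm hk).monotone h)
    simp only [ellipticF_jacobiAm hk] at h1
    have := le_abs_self (u - v)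
    rw [Real.dist_eq]
    linarith
  · have := (strictMono_jacobiAm hk).monotone h
    linarith [dist_nonneg (x := u) (y := v)]

theorem jacobiDn_pos (hk : k ^ 2 < 1) (u : ℝ) : 0 < jacobiDn u k :=
  Real.sqrt_pos.2 (ellipticF_integrand_pos hk _)

theorem jacobiDn_sq (hk : k ^ 2 < 1) (u : ℝ) :
    jacobiDn u k ^ 2 = 1 - k ^ 2 * jacobiSn u k ^ 2 :=
  Real.sq_sqrt (ellipticF_integrand_pos hk _).le

theorem jacobiCn_sq (u k : ℝ) : jacobiCn u k ^ 2 = 1 - jacobiSn u k ^ 2 := Real.cos_sq' _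

theorem hasDerivAt_jacobiAm (hk : k ^ 2 < 1) (u : ℝ) :
    HasDerivAt (fun u => jacobiAm u k) (jacobiDn u k) u := by
  have hc := continuous_ellipticF_integrand hk
  have hF : HasDerivAt (ellipticF k) (1 / jacobiDn u k) (jacobiAm u k) :=
    intervalIntegral.integral_hasDerivAt_right (hc.intervalIntegrable _ _)
      (hc.stronglyMeasurableAtFilter _ _) hc.continuousAt
  have h := HasDerivAt.of_local_left_inverse (continuous_jacobiAm hk).continuousAt hF
    (one_div_pos.2 (jacobiDn_pos hk u)).ne' (.of_forall (ellipticF_jacobiAm hk))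
  simpa using h

theorem hasDerivAt_jacobiSn (hk : k ^ 2 < 1) (u : ℝ) :
    HasDerivAt (fun u => jacobiSn u k) (jacobiCn u k * jacobiDn u k) u :=
  (hasDerivAt_jacobiAm hk u).sin

theorem hasDerivAt_jacobiCn (hk : k ^ 2 < 1) (u : ℝ) :
    HasDerivAt (fun u => jacobiCn u k) (-jacobiSn u k * jacobiDn u k) u :=
  (hasDerivAt_jacobiAm hk u).cos

theorem hasDerivAt_jacobiDn (hk : k ^ 2 < 1) (u : ℝ) :
    HasDerivAt (fun u => jacobiDn u k) (-k ^ 2 * jacobiSn u k * jacobiCn u k) u := by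
  refine ((((hasDerivAt_jacobiSn hk u).fun_pow 2).const_mul (k ^ 2)).const_sub 1).sqrt
    (ellipticF_integrand_pos hk _).ne' |>.congr_deriv ?_
  have h := (jacobiDn_pos hk u).ne'
  rw [show √(1 - k ^ 2 * jacobiSn u k ^ 2) = jacobiDn u k from rfl]
  field_simp
  push_cast
  ring

theorem continuous_jacobiSn (hk : k ^ 2 < 1) : Continuous fun u => jacobiSn u k :=
  continuous_iff_continuousAt.2 fun u => (hasDerivAt_jacobiSn hk u).continuousAt

theorem continuous_jacobiCn (hk : k ^ 2 < 1) : Continuous fun u => jacobiCn u k :=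
  continuous_iff_continuousAt.2 fun u => (hasDerivAt_jacobiCn hk u).continuousAt

theorem continuous_jacobiDn (hk : k ^ 2 < 1) : Continuous fun u => jacobiDn u k :=
  continuous_iff_continuousAt.2 fun u => (hasDerivAt_jacobiDn hk u).continuousAt

theorem jacobiSn_zero (hk : k ^ 2 < 1) : jacobiSn 0 k = 0 := by
  simp [jacobiSn, jacobiAm_zero hk]

theorem jacobiSn_ellipticK (hk : k ^ 2 < 1) : jacobiSn (ellipticK k) k = 1 := by
  simp [jacobiSn, jacobiAm_ellipticK hk]

theorem jacobiCn_ellipticK (hk : k ^ 2 < 1) : jacobiCn (ellipticK k) k = 0 := by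
  simp [jacobiCn, jacobiAm_ellipticK hk]

theorem jacobiAm_mem_Icc (hk : k ^ 2 < 1) {u : ℝ} (hu : u ∈ Icc 0 (ellipticK k)) :
    jacobiAm u k ∈ Icc 0 (Real.pi / 2) := by
  have h1 := (strictMono_jacobiAm hk).monotone hu.1
  have h2 := (strictMono_jacobiAm hk).monotone hu.2
  simp only [jacobiAm_zero hk, jacobiAm_ellipticK hk] at h1 h2
  exact ⟨h1, h2⟩

theorem strictMonoOn_jacobiSn (hk : k ^ 2 < 1) :
    StrictMonoOn (fun u => jacobiSn u k) (Icc 0 (ellipticK k)) := fun u hu v hv huv =>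
  Real.sin_lt_sin_of_lt_of_le_pi_div_two
    (by linarith [(jacobiAm_mem_Icc hk hu).1, Real.pi_pos]) (jacobiAm_mem_Icc hk hv).2
    (strictMono_jacobiAm hk huv)

theorem jacobiSn_nonneg (hk : k ^ 2 < 1) {u : ℝ} (hu : u ∈ Icc 0 (ellipticK k)) :
    0 ≤ jacobiSn u k :=
  Real.sin_nonneg_of_mem_Icc ⟨(jacobiAm_mem_Icc hk hu).1,
    by linarith [(jacobiAm_mem_Icc hk hu).2, Real.pi_pos]⟩

theorem strictMonoOn_jacobiSn_sq (hk : k ^ 2 < 1) :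
    StrictMonoOn (fun u => jacobiSn u k ^ 2) (Icc 0 (ellipticK k)) := fun _ hu _ hv huv =>
  pow_lt_pow_left₀ (strictMonoOn_jacobiSn hk hu hv huv) (jacobiSn_nonneg hk hu) two_ne_zero

theorem jacobiSn_sq_mem_Ioo (hk : k ^ 2 < 1) {u : ℝ} (hu : u ∈ Ioo 0 (ellipticK k)) :
    jacobiSn u k ^ 2 ∈ Ioo (0 : ℝ) 1 := by
  have h0 := left_mem_Icc.2 (ellipticK_pos hk).le
  have hK := right_mem_Icc.2 (ellipticK_pos hk).le
  have h1 := strictMonoOn_jacobiSn_sq hk h0 (Ioo_subset_Icc_self hu) hu.1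
  have h2 := strictMonoOn_jacobiSn_sq hk (Ioo_subset_Icc_self hu) hK hu.2
  simp only [jacobiSn_zero hk, jacobiSn_ellipticK hk] at h1 h2
  exact ⟨by linarith, by linarith⟩

theorem exists_jacobiSn_sq_eq (hk : k ^ 2 < 1) {z : ℝ} (hz : z ∈ Ioo (0 : ℝ) 1) :
    ∃ u ∈ Ioo 0 (ellipticK k), jacobiSn u k ^ 2 = z :=
  intermediate_value_Ioo (ellipticK_pos hk).le
    (f := fun u => jacobiSn u k ^ 2) ((continuous_jacobiSn hk).pow 2).continuousOn
    (by simpa [jacobiSn_zero hk, jacobiSn_ellipticK hk] using hz)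

end Jacobi

/-! ### Moduli and bounds for the coefficients p and q. -/

section Coefficients

variable {a b c : ℝ}

theorem modulus_sq (hab : b < a) (hbc : c < b) (hc : 0 < c) :
    modulus a b c ^ 2 = (a ^ 2 - b ^ 2) / (a ^ 2 - c ^ 2) :=
  Real.sq_sqrt (div_nonneg (by nlinarith) (by nlinarith))

theorem coModulus_sq (hab : b < a) (hbc : c < b) (hc : 0 < c) :
    coModulus a b c ^ 2 = 1 - modulus a b c ^ 2 := by
  have h : a ^ 2 - c ^ 2 ≠ 0 := by nlinarith
  rw [modulus_sq hab hbc hc, coModulus, Real.sq_sqrt (div_nonneg (by nlinarith) (by nlinarith))]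
  field_simp
  ring

theorem modulus_sq_mem (hab : b < a) (hbc : c < b) (hc : 0 < c) :
    modulus a b c ^ 2 ∈ Ioo (0 : ℝ) 1 := by
  rw [modulus_sq hab hbc hc]
  exact ⟨div_pos (by nlinarith) (by nlinarith), (div_lt_one (by nlinarith)).2 (by nlinarith)⟩

theorem modulus_pos (hab : b < a) (hbc : c < b) (hc : 0 < c) : 0 < modulus a b c :=
  Real.sqrt_pos.2 (div_pos (by nlinarith) (by nlinarith))

theorem coModulus_pos (hab : b < a) (hbc : c < b) (hc : 0 < c) : 0 < coModulus a b c :=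
  Real.sqrt_pos.2 (div_pos (by nlinarith) (by nlinarith))

theorem coModulus_sq_lt_one (hab : b < a) (hbc : c < b) (hc : 0 < c) :
    coModulus a b c ^ 2 < 1 := by
  linarith [coModulus_sq hab hbc hc, (modulus_sq_mem hab hbc hc).1]

theorem continuous_pCoeff (hab : b < a) (hbc : c < b) (hc : 0 < c) :
    Continuous (pCoeff a b c) := by
  have := continuous_jacobiSn (coModulus_sq_lt_one hab hbc hc)
  have := continuous_jacobiCn (coModulus_sq_lt_one hab hbc hc)
  unfold pCoeff
  fun_prop

theorem continuous_qCoeff (hab : b < a) (hbc : c < b) (hc : 0 < c) :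
    Continuous (qCoeff a b c) := by
  have := continuous_jacobiSn (modulus_sq_mem hab hbc hc).2
  have := continuous_jacobiCn (modulus_sq_mem hab hbc hc).2
  unfold qCoeff
  fun_prop

theorem jacobiSn_sq_le_one (u k : ℝ) : jacobiSn u k ^ 2 ≤ 1 := Real.sin_sq_le_one _

theorem le_pCoeff (hbc : c < b) (hc : 0 < c) (s : ℝ) : c ≤ pCoeff a b c s := by
  refine Real.le_sqrt_of_sq_le ?_
  have h := mul_nonneg (show 0 ≤ b ^ 2 - c ^ 2 by nlinarith)
    (sq_nonneg (jacobiSn s (coModulus a b c)))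
  rw [jacobiCn_sq]
  linarith

theorem pCoeff_le (hbc : c < b) (hc : 0 < c) (s : ℝ) : pCoeff a b c s ≤ b := by
  refine Real.sqrt_le_iff.2 ⟨by linarith, ?_⟩
  have h := mul_nonneg (show 0 ≤ b ^ 2 - c ^ 2 by nlinarith)
    (sub_nonneg.2 (jacobiSn_sq_le_one s (coModulus a b c)))
  rw [jacobiCn_sq]
  linarith

theorem le_qCoeff (hab : b < a) (hb : 0 < b) (t : ℝ) : b ≤ qCoeff a b c t := by
  refine Real.le_sqrt_of_sq_le ?_
  have h := mul_nonneg (show 0 ≤ a ^ 2 - b ^ 2 by nlinarith)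
    (sub_nonneg.2 (jacobiSn_sq_le_one t (modulus a b c)))
  rw [jacobiCn_sq]
  linarith

theorem qCoeff_le (hab : b < a) (hb : 0 < b) (t : ℝ) : qCoeff a b c t ≤ a := by
  refine Real.sqrt_le_iff.2 ⟨by linarith, ?_⟩
  have h := mul_nonneg (show 0 ≤ a ^ 2 - b ^ 2 by nlinarith)
    (sq_nonneg (jacobiSn t (modulus a b c)))
  rw [jacobiCn_sq]
  linarith

/-- At their right ends p and q both equal b, so c < b < a gives the strict inequality that
`IsPruferAngle.lt_of_coeff_le` needs there. -/
theorem pCoeff_ellipticK (hab : b < a) (hbc : c < b) (hc : 0 < c) :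
    pCoeff a b c (ellipticK (coModulus a b c)) = b := by
  have h := coModulus_sq_lt_one hab hbc hc
  rw [pCoeff, jacobiSn_ellipticK h, jacobiCn_ellipticK h]
  simp [Real.sqrt_sq (hc.trans hbc).le]

theorem qCoeff_ellipticK (hab : b < a) (hbc : c < b) (hc : 0 < c) :
    qCoeff a b c (ellipticK (modulus a b c)) = b := by
  have h := (modulus_sq_mem hab hbc hc).2
  rw [qCoeff, jacobiSn_ellipticK h, jacobiCn_ellipticK h]
  simp [Real.sqrt_sq (hc.trans hbc).le]

end Coefficients

/-! ### Lamé polynomials and the eigenvalues of the sphere. -/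

section Lame

open Polynomial

theorem eval_derivative_prod_X_sub_C {ι : Type*} [Fintype ι] [DecidableEq ι] (θ : ι → ℝ) (i : ι) :
    (derivative (∏ j, (X - C (θ j)))).eval (θ i) =
        (∏ j ∈ Finset.univ.erase i, (X - C (θ j))).eval (θ i) ∧
      (derivative (derivative (∏ j, (X - C (θ j))))).eval (θ i) =
        2 * (derivative (∏ j ∈ Finset.univ.erase i, (X - C (θ j)))).eval (θ i) := by
  rw [← Finset.mul_prod_erase _ _ (Finset.mem_univ i)]
  constructor
  · simp
  · simp [derivative_mul]
    ring

/-- Stieltjes' electrostatic argument: the configuration of maximal energy consists of the roots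
of a polynomial `E` such that `2 A E'' + B E'` vanishes at the roots of `E`. -/
theorem exists_stieltjes_configuration {ι : Type*} [Fintype ι] [DecidableEq ι] {P A B : ℝ[X]}
    (hAB : A * derivative P = B * P) {l u θ₀ : ι → ℝ} (hl : ∀ i, P.eval (l i) = 0)
    (hu : ∀ i, P.eval (u i) = 0) (h0 : Function.Injective θ₀)
    (h0m : ∀ i, θ₀ i ∈ Icc (l i) (u i)) (h0P : ∀ i, P.eval (θ₀ i) ≠ 0) :
    ∃ θ : ι → ℝ, Function.Injective θ ∧ (∀ i, θ i ∈ Ioo (l i) (u i)) ∧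
      ∀ i, (2 * A * derivative (derivative (∏ j, (X - C (θ j)))) +
        B * derivative (∏ j, (X - C (θ j)))).eval (θ i) = 0 := by
  -- Even powers replace absolute values. Each unordered pair occurs twice, so F is the square of ∏
  -- P(θ i) ∏_{i<j} (θ i - θ j)⁴.
  set F : (ι → ℝ) → ℝ := fun θ =>
    ∏ i, (P.eval (θ i) ^ 2 * ∏ j ∈ Finset.univ.erase i, (θ i - θ j) ^ 4) with hF
  have hFc : Continuous F := by fun_prop
  obtain ⟨θ, hθ, hmax⟩ := (isCompact_univ_pi fun i =>
    isCompact_Icc (a := l i) (b := u i)).exists_isMaxOn ⟨θ₀, fun i _ => h0m i⟩ hFc.continuousOn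
  have hF0 : F θ ≠ 0 := by
    have h1 : 0 < F θ₀ := Finset.prod_pos fun i _ => mul_pos (even_two.pow_pos (h0P i))
      (Finset.prod_pos fun j hj =>
        (by decide : Even 4).pow_pos (sub_ne_zero.2 (h0.ne (Finset.ne_of_mem_erase hj).symm)))
    exact (h1.trans_le (hmax fun i _ => h0m i)).ne'
  have hPne : ∀ i, P.eval (θ i) ≠ 0 := fun i hi => hF0
    (Finset.prod_eq_zero (Finset.mem_univ i) (by simp [hi]))
  have hinj : Function.Injective θ := fun i j hij => by
    by_contra hne
    exact hF0 (Finset.prod_eq_zero (Finset.mem_univ i) (mul_eq_zero_of_right _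
      (Finset.prod_eq_zero (Finset.mem_erase.2 ⟨Ne.symm hne, Finset.mem_univ j⟩) (by simp [hij]))))
  have hIoo : ∀ i, θ i ∈ Ioo (l i) (u i) := fun i => by
    have h := hθ i (mem_univ i)
    refine ⟨lt_of_le_of_ne h.1 fun he => hPne i (he ▸ hl i),
      lt_of_le_of_ne h.2 fun he => hPne i (he ▸ hu i)⟩
  refine ⟨θ, hinj, hIoo, fun i => ?_⟩
  set Ei : ℝ[X] := ∏ j ∈ Finset.univ.erase i, (X - C (θ j)) with hEi
  have hEie : ∀ x, Ei.eval x = ∏ j ∈ Finset.univ.erase i, (x - θ j) := fun x => by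
    simp [hEi, eval_prod]
  have hEi0 : Ei.eval (θ i) ≠ 0 := by
    rw [hEie]
    exact Finset.prod_ne_zero_iff.2 fun j hj =>
      sub_ne_zero.2 (hinj.ne (Finset.ne_of_mem_erase hj).symm)
  -- As a function of one coordinate, F is a constant times (P Ei⁴)²: one factor Ei⁴ comes from row
  -- i, the other from the remaining rows.
  obtain ⟨D, hD0, hD⟩ : ∃ D : ℝ, 0 ≤ D ∧
      ∀ x, F (Function.update θ i x) = (P.eval x * Ei.eval x ^ 4) ^ 2 * D := by
    refine ⟨∏ i' ∈ Finset.univ.erase i, (P.eval (θ i') ^ 2 *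
      ∏ j ∈ (Finset.univ.erase i').erase i, (θ i' - θ j) ^ 4), by positivity, fun x => ?_⟩
    have h1 : ∀ j ∈ Finset.univ.erase i, Function.update θ i x j = θ j := fun j hj =>
      Function.update_of_ne (Finset.ne_of_mem_erase hj) _ _
    have h2 : ∀ i' ∈ Finset.univ.erase i, P.eval (Function.update θ i x i') ^ 2 *
        ∏ j ∈ Finset.univ.erase i', (Function.update θ i x i' - Function.update θ i x j) ^ 4 =
        (x - θ i') ^ 4 * (P.eval (θ i') ^ 2 *
          ∏ j ∈ (Finset.univ.erase i').erase i, (θ i' - θ j) ^ 4) := fun i' hi' => by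
      have hii : i ∈ Finset.univ.erase i' :=
        Finset.mem_erase.2 ⟨(Finset.ne_of_mem_erase hi').symm, Finset.mem_univ i⟩
      rw [h1 i' hi', ← Finset.mul_prod_erase _ _ hii, Function.update_self]
      have h3 : ∏ j ∈ (Finset.univ.erase i').erase i, (θ i' - Function.update θ i x j) ^ 4 =
          ∏ j ∈ (Finset.univ.erase i').erase i, (θ i' - θ j) ^ 4 :=
        Finset.prod_congr rfl fun j hj => by
          rw [Function.update_of_ne (Finset.ne_of_mem_erase hj)]
      rw [h3]
      ring
    simp only [hF]
    rw [← Finset.mul_prod_erase _ _ (Finset.mem_univ i), Finset.prod_congr rfl h2,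
      Finset.prod_mul_distrib, Function.update_self,
      Finset.prod_congr rfl fun j hj => by rw [h1 j hj], hEie, Finset.prod_pow]
    ring
  have hDpos : 0 < D := lt_of_le_of_ne hD0 fun h => hF0 (by
    rw [← Function.update_eq_self i θ, hD, ← h, mul_zero])
  have hloc : IsLocalMax (fun x => ((P * Ei ^ 4) ^ 2).eval x) (θ i) := by
    filter_upwards [Icc_mem_nhds (hIoo i).1 (hIoo i).2] with x hx
    have hle : F (Function.update θ i x) ≤ F θ := hmax fun j _ => by
      by_cases hj : j = i
      · subst hj; simpa using hx
      · simpa [Function.update_of_ne hj] using hθ j (mem_univ j)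
    have h4 := hD (θ i)
    rw [Function.update_eq_self] at h4
    rw [hD, h4] at hle
    simpa using le_of_mul_le_mul_right hle hDpos
  -- Criticality reads P'/P + 4 Ei'/Ei = 0 at θ i. Since P'/P = B/A, E' = Ei and E'' = 2 Ei' there,
  -- this is 2 A E'' + B E' = 0.
  have hder := hloc.hasDerivAt_eq_zero (Polynomial.hasDerivAt _ _)
  obtain ⟨h5, h6⟩ := eval_derivative_prod_X_sub_C θ i
  have h7 := congrArg (eval (θ i)) hAB
  simp only [eval_mul, eval_add, eval_ofNat, h5, h6, ← hEi] at h7 ⊢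
  have h8 : Ei.eval (θ i) ^ 3 * ((derivative P).eval (θ i) * Ei.eval (θ i)
      + 4 * P.eval (θ i) * (derivative Ei).eval (θ i)) = 0 := by
    simp only [derivative_mul, derivative_pow, eval_mul, eval_add, eval_pow, eval_C] at hder
    have h9 := (mul_eq_zero.1 hder).resolve_left
      (by have := hPne i; simpa using ⟨this, hEi0⟩)
    simp only [Nat.cast_ofNat] at h9
    linear_combination h9
  have h9 := (mul_eq_zero.1 h8).resolve_left (pow_ne_zero _ hEi0)
  refine (mul_eq_zero.1 ?_).resolve_left (hPne i)
  linear_combination A.eval (θ i) * h9 - Ei.eval (θ i) * h7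

/-- The roots of E are distinct, so E divides the left side, whose degree is at most N + 1; the
quotient is linear and its slope is read off the leading coefficients. -/
theorem stieltjes_equation {ι : Type*} [Fintype ι] {A B : ℝ[X]} {θ : ι → ℝ}
    (hθ : Function.Injective θ) (hA : A.natDegree ≤ 3) (hA3 : A.coeff 3 = 1)
    (hB : B.natDegree ≤ 2)
    (h : ∀ i, (2 * A * derivative (derivative (∏ j, (X - C (θ j)))) +
      B * derivative (∏ j, (X - C (θ j)))).eval (θ i) = 0) :
    ∃ d : ℝ, 2 * A * derivative (derivative (∏ j, (X - C (θ j)))) +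
      B * derivative (∏ j, (X - C (θ j))) =
      (C (Fintype.card ι * (2 * (Fintype.card ι - 1) + B.coeff 2)) * X + C d) *
        ∏ j, (X - C (θ j)) := by
  set E : ℝ[X] := ∏ j, (X - C (θ j)) with hE
  set N := Fintype.card ι with hN
  have hmonic : E.Monic := monic_prod_X_sub_C θ Finset.univ
  have hdeg : E.natDegree = N := by
    rw [hE, natDegree_finsetProd_X_sub_C_eq_card, Finset.card_univ]
  have hdvd : E ∣ 2 * A * derivative (derivative E) + B * derivative E :=
    Finset.prod_dvd_of_coprime (fun i _ j _ hij => pairwise_coprime_X_sub_C hθ hij)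
      fun i _ => dvd_iff_isRoot.2 (h i)
  obtain ⟨Q, hQ⟩ := hdvd
  have hEN : E.coeff N = 1 := by rw [← hdeg]; exact hmonic
  have h1 : (derivative E).natDegree ≤ N - 1 := hdeg ▸ natDegree_derivative_le E
  have h2 : (derivative (derivative E)).natDegree ≤ N - 1 - 1 :=
    (natDegree_derivative_le _).trans (by omega)
  have key : (2 * A * derivative (derivative E) + B * derivative E).natDegree ≤ N + 1 ∧
      (2 * A * derivative (derivative E) + B * derivative E).coeff (N + 1) =
        N * (2 * (N - 1) + B.coeff 2) := by
    clear_value N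
    have hA2 : (2 * A).natDegree ≤ 3 := by
      have h := (natDegree_C_mul_le (2 : ℝ) A).trans hA
      rwa [map_ofNat] at h
    -- N = 0 and N = 1 are separate because the degrees N - 1 and N - 2 of the derivatives truncate.
    rcases N with - | - | M
    · have h0 : derivative E = 0 := derivative_of_natDegree_zero hdeg
      simp [h0]
    · have h0 : derivative (derivative E) = 0 :=
        derivative_of_natDegree_zero (Nat.le_zero.1 h1)
      have h4 := natDegree_mul_le_of_le hB h1
      have h5 := coeff_mul_add_eq_of_natDegree_le hB h1
      rw [coeff_derivative] at h5
      simp only [h0, mul_zero, zero_add]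
      refine ⟨h4, h5.trans ?_⟩
      simp only [zero_add] at hEN
      simp [hEN]
    · have h3 := natDegree_mul_le_of_le hA2 h2
      have h4 := natDegree_mul_le_of_le hB h1
      have h5 := coeff_mul_add_eq_of_natDegree_le hB h1
      have h6 := coeff_mul_add_eq_of_natDegree_le hA2 h2
      simp only [Nat.add_sub_cancel, coeff_derivative] at h3 h4 h5 h6
      refine ⟨natDegree_add_le_of_degree_le (h3.trans (by omega)) (h4.trans (by omega)), ?_⟩
      rw [coeff_add, show M + 1 + 1 + 1 = 3 + M by omega, h6, show 3 + M = 2 + (M + 1) by omega, h5]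
      simp only [hEN]
      rw [show (2 * A).coeff 3 = 2 by rw [coeff_ofNat_mul, hA3]; norm_num]
      push_cast
      ring
  have hQ1 : Q.natDegree ≤ 1 := by
    rcases eq_or_ne Q 0 with rfl | hQ0
    · simp
    · have := key.1
      rw [hQ, hmonic.natDegree_mul' hQ0, hdeg] at this
      omega
  refine ⟨Q.coeff 0, ?_⟩
  have h3 := key.2
  rw [hQ, coeff_mul_add_eq_of_natDegree_le hdeg.le hQ1, hEN, one_mul] at h3
  rw [hQ, mul_comm, ← h3]
  congr 1
  exact eq_X_add_C_of_natDegree_le_one hQ1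

/-- This is Lamé's equation in z = sn² after removal of the prefactor; the distribution of roots
over the two intervals will prescribe the two zero counts. -/
theorem exists_lame_polynomial {s : ℝ} (hs : s ∈ Ioo (0 : ℝ) 1) (e₁ e₃ m n : ℕ) :
    ∃ θ : Fin n ⊕ Fin m → ℝ, Function.Injective θ ∧ (∀ i, θ (.inl i) ∈ Ioo 0 1) ∧
      (∀ i, θ (.inr i) ∈ Ioo 1 s⁻¹) ∧ ∃ d : ℝ, ∀ z : ℝ,
      4 * z * (1 - z) * (1 - s * z) *
          (derivative (derivative (∏ j, (X - C (θ j))))).eval z +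
        2 * ((2 * e₁ + 1) * (1 - z) * (1 - s * z) - 3 * z * (1 - s * z)
          - (2 * e₃ + 1) * s * z * (1 - z)) * (derivative (∏ j, (X - C (θ j)))).eval z =
      (s * (2 * (n + m) * (2 * (n + m) + 1 + 2 * (e₁ + 1 + e₃))) * z + d) *
        (∏ j, (X - C (θ j))).eval z := by
  obtain ⟨hs0, hs1⟩ := hs
  have ht : 1 < s⁻¹ := (one_lt_inv₀ hs0).2 hs1
  -- The exponents are 2e + 1 for the parities e₁, 1, e₃ at 0, 1, s⁻¹; the middle 3 is the Dirichlet
  -- parity. They make B/A = P'/P the first-order coefficient of Lamé's equation.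
  set P : ℝ[X] := X ^ (2 * e₁ + 1) * (X - C 1) ^ 3 * (X - C s⁻¹) ^ (2 * e₃ + 1) with hP
  set A : ℝ[X] := X * (X - C 1) * (X - C s⁻¹) with hA
  set B : ℝ[X] := C (2 * e₁ + 1 : ℝ) * ((X - C 1) * (X - C s⁻¹)) + C 3 * (X * (X - C s⁻¹)) +
    C (2 * e₃ + 1 : ℝ) * (X * (X - C 1)) with hB
  have hAB : A * derivative P = B * P := by
    simp only [hA, hB, hP, derivative_mul, derivative_X_pow, derivative_X_sub_C_pow,
      Nat.add_sub_cancel]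
    simp only [map_add, map_mul, map_natCast, map_ofNat, map_one]
    push_cast
    ring
  have hPe : ∀ x, P.eval x = x ^ (2 * e₁ + 1) * (x - 1) ^ 3 * (x - s⁻¹) ^ (2 * e₃ + 1) :=
    fun x => by simp [hP]
  have hfin : ∀ {N : ℕ} (i : Fin N), 0 < ((i : ℝ) + 1) / (N + 1) ∧ ((i : ℝ) + 1) / (N + 1) < 1 :=
    fun {N} i => ⟨by positivity, (div_lt_one (by positivity)).2 (by
      have : (i : ℝ) < N := by exact_mod_cast i.2
      linarith)⟩
  have hfinj : ∀ {N : ℕ} (i j : Fin N),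
      ((i : ℝ) + 1) / (N + 1) = ((j : ℝ) + 1) / (N + 1) → i = j := fun {N} i j hij => by
    have h1 : (0 : ℝ) < N + 1 := by positivity
    have h2 := add_right_cancel ((div_left_inj' h1.ne').1 hij)
    exact Fin.ext (by exact_mod_cast h2)
  obtain ⟨θ, hinj, hθ, hroot⟩ := exists_stieltjes_configuration hAB
    (l := Sum.elim (fun _ : Fin n => 0) fun _ : Fin m => 1)
    (u := Sum.elim (fun _ => 1) fun _ => s⁻¹)
    (θ₀ := Sum.elim (fun i => ((i : ℝ) + 1) / (n + 1))
      fun i => 1 + (s⁻¹ - 1) * (((i : ℝ) + 1) / (m + 1)))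
    (by rintro (i | i) <;> simp [hPe]) (by rintro (i | i) <;> simp [hPe])
    (by
      rintro (i | i) (j | j) hij <;> simp only [Sum.elim_inl, Sum.elim_inr] at hij
      · rw [hfinj i j hij]
      · nlinarith [hfin i, hfin j]
      · nlinarith [hfin i, hfin j]
      · rw [hfinj i j (mul_left_cancel₀ (sub_pos.2 ht).ne' (add_left_cancel hij))])
    (by
      rintro (i | i) <;> simp only [Sum.elim_inl, Sum.elim_inr]
      · exact ⟨(hfin i).1.le, (hfin i).2.le⟩
      · constructor <;> nlinarith [hfin i])
    (by
      rintro (i | i) <;> simp only [Sum.elim_inl, Sum.elim_inr, hPe]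
      · obtain ⟨h1, h2⟩ := hfin i
        exact mul_ne_zero (mul_ne_zero (pow_ne_zero _ h1.ne')
          (pow_ne_zero _ (sub_neg.2 h2).ne)) (pow_ne_zero _ (by linarith))
      · obtain ⟨h1, h2⟩ := hfin i
        have h3 := mul_pos (sub_pos.2 ht) h1
        have h4 := mul_lt_of_lt_one_right (sub_pos.2 ht) h2
        exact mul_ne_zero (mul_ne_zero (pow_ne_zero _ (by linarith))
          (pow_ne_zero _ (by linarith))) (pow_ne_zero _ (by linarith)))
  refine ⟨θ, hinj, fun i => hθ (.inl i), fun i => hθ (.inr i), ?_⟩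
  have hBdeg : B.natDegree ≤ 2 := by rw [hB]; compute_degree
  have hB2 : B.coeff 2 = 2 * e₁ + 2 * e₃ + 5 := by
    rw [hB]
    have : C (2 * e₁ + 1 : ℝ) * ((X - C 1) * (X - C s⁻¹)) + C 3 * (X * (X - C s⁻¹)) +
        C (2 * e₃ + 1 : ℝ) * (X * (X - C 1)) = C (2 * e₁ + 2 * e₃ + 5 : ℝ) * X ^ 2 +
        C (-(2 * e₁ + 1) * (1 + s⁻¹) - 3 * s⁻¹ - (2 * e₃ + 1)) * X + C ((2 * e₁ + 1) * s⁻¹) := by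
      simp only [map_add, map_mul, map_sub, map_neg, map_one, map_ofNat]
      ring
    rw [this]
    simp only [coeff_add, coeff_C_mul, coeff_X_pow, coeff_X, coeff_C]
    norm_num
  have hAdeg : A.natDegree ≤ 3 := by rw [hA]; compute_degree
  have hA3 : A.coeff 3 = 1 := by
    have : A = X ^ 3 + C (-(1 + s⁻¹)) * X ^ 2 + C s⁻¹ * X := by
      rw [hA]
      simp only [map_add, map_neg, map_one]
      ring
    rw [this]
    simp only [coeff_add, coeff_C_mul, coeff_X_pow, coeff_X]
    norm_num
  obtain ⟨d, hd⟩ := stieltjes_equation hinj hAdeg hA3 hBdeg hroot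
  refine ⟨2 * s * d, fun z => ?_⟩
  have h := congrArg (eval z) hd
  rw [hB2] at h
  simp only [hA, hB, eval_add, eval_mul, eval_sub, eval_X, eval_C, eval_ofNat, Fintype.card_sum,
    Fintype.card_fin, Nat.cast_add] at h
  generalize (derivative (derivative (∏ j, (X - C (θ j))))).eval z = E2 at h ⊢
  generalize (derivative (∏ j, (X - C (θ j)))).eval z = E1 at h ⊢
  generalize (∏ j, (X - C (θ j))).eval z = E0 at h ⊢
  have hss : s * s⁻¹ = 1 := mul_inv_cancel₀ hs0.ne'
  linear_combination 2 * s * h + (4 * z * (z - 1) * E2 + 2 * (2 * e₁ + 1) * (z - 1) * E1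
    + 6 * z * E1) * hss

/-- The sign ε covers both variables: ε = 1 for (sn, cn, dn) of modulus k, and ε = -1 for (dn/k, k'
cn/k, k' sn) of modulus k'. The product is the Lamé function of lowest degree for the given
parities; the third conclusion is its logarithmic derivative without denominators. -/
theorem lame_prefactor {s ε : ℝ} {X₁ X₂ X₃ : ℝ → ℝ} (hε : ε ^ 2 = 1)
    (h₁ : ∀ x, HasDerivAt X₁ (ε * X₂ x * X₃ x) x) (h₂ : ∀ x, HasDerivAt X₂ (-X₁ x * X₃ x) x)
    (h₃ : ∀ x, HasDerivAt X₃ (-ε * s * X₁ x * X₂ x) x) (h12 : ∀ x, X₂ x ^ 2 = ε * (1 - X₁ x ^ 2))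
    (h13 : ∀ x, X₃ x ^ 2 = 1 - s * X₁ x ^ 2) (κ₁ κ₃ : Fin 2) :
    ∃ dG : ℝ → ℝ,
      (∀ x, HasDerivAt (fun x => X₁ x ^ κ₁.val * X₂ x * X₃ x ^ κ₃.val) (dG x) x) ∧
      (∀ x, HasDerivAt dG (-ε * ((κ₁.val + 1) ^ 2 + s * (κ₁.val + κ₃.val) ^ 2
        - (κ₁.val + 1 + κ₃.val) * (κ₁.val + 1 + κ₃.val + 1) * s * X₁ x ^ 2) *
          (X₁ x ^ κ₁.val * X₂ x * X₃ x ^ κ₃.val)) x) ∧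
      (∀ x, dG x * (X₁ x * X₂ x * X₃ x) = (κ₁.val * (1 - X₁ x ^ 2) * (1 - s * X₁ x ^ 2)
        - X₁ x ^ 2 * (1 - s * X₁ x ^ 2) - κ₃.val * s * X₁ x ^ 2 * (1 - X₁ x ^ 2)) *
          (X₁ x ^ κ₁.val * X₂ x * X₃ x ^ κ₃.val)) ∧
      (κ₁ = 0 → ∀ x, X₁ x = 0 → dG x = 0) ∧ (κ₃ = 0 → ∀ x, X₃ x = 0 → dG x = 0) := by
  have e12 : ∀ x, ε * X₂ x ^ 2 = 1 - X₁ x ^ 2 := fun x => by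
    linear_combination ε * h12 x + (1 - X₁ x ^ 2) * hε
  fin_cases κ₁ <;> fin_cases κ₃ <;> simp only [Fin.zero_eta, Fin.mk_one, 
    pow_zero, pow_one, one_mul, mul_one, Nat.cast_zero, Nat.cast_one]
  · refine ⟨fun x => -X₁ x * X₃ x, h₂, fun x => ?_, fun x => ?_, fun _ x hx => ?_, fun _ x hx => ?_⟩
    · refine ((h₁ x).fun_neg.fun_mul (h₃ x)).congr_deriv ?_
      linear_combination -ε * X₂ x * h13 x
    · linear_combination -X₁ x ^ 2 * X₂ x * h13 x
    · simp [hx]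
    · simp [hx]
  · refine ⟨fun x => -X₁ x * X₃ x * X₃ x + X₂ x * (-ε * s * X₁ x * X₂ x),
      fun x => (h₂ x).fun_mul (h₃ x), fun x => ?_, fun x => ?_, fun _ x hx => ?_, fun h => ?_⟩
    · refine ((((h₁ x).fun_neg.fun_mul (h₃ x)).fun_mul (h₃ x)).fun_add ((h₂ x).fun_mul
        (((h₁ x).const_mul (-ε * s)).fun_mul (h₂ x)))).congr_deriv ?_
      have h4 := h12 x
      have h5 := h13 x
      have h6 := e12 x
      clear e12 h12 h13 h₁ h₂ h₃
      generalize X₁ x = u at *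
      generalize X₂ x = v at *
      generalize X₃ x = w at *
      norm_num
      grind
    · beta_reduce
      have h4 := h12 x
      have h5 := h13 x
      have h6 := e12 x
      clear e12 h12 h13 h₁ h₂ h₃
      generalize X₁ x = u at *
      generalize X₂ x = v at *
      generalize X₃ x = w at *
      norm_num
      grind
    · simp [hx]
    · simp at h
  · refine ⟨fun x => ε * X₂ x * X₃ x * X₂ x + X₁ x * (-X₁ x * X₃ x),
      fun x => (h₁ x).fun_mul (h₂ x), fun x => ?_, fun x => ?_, fun h => ?_, fun _ x hx => ?_⟩
    · refine (((((h₂ x).const_mul ε).fun_mul (h₃ x)).fun_mul (h₂ x)).fun_add ((h₁ x).fun_mul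
        ((h₁ x).fun_neg.fun_mul (h₃ x)))).congr_deriv ?_
      have h4 := h12 x
      have h5 := h13 x
      have h6 := e12 x
      clear e12 h12 h13 h₁ h₂ h₃
      generalize X₁ x = u at *
      generalize X₂ x = v at *
      generalize X₃ x = w at *
      norm_num
      grind
    · beta_reduce
      have h4 := h12 x
      have h5 := h13 x
      have h6 := e12 x
      clear e12 h12 h13 h₁ h₂ h₃
      generalize X₁ x = u at *
      generalize X₂ x = v at *
      generalize X₃ x = w at *
      norm_num
      grind
    · simp at h
    · simp [hx]
  · refine ⟨fun x => (ε * X₂ x * X₃ x * X₂ x + X₁ x * (-X₁ x * X₃ x)) * X₃ x +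
        X₁ x * X₂ x * (-ε * s * X₁ x * X₂ x),
      fun x => ((h₁ x).fun_mul (h₂ x)).fun_mul (h₃ x), fun x => ?_, fun x => ?_, fun h => ?_,
      fun h => ?_⟩
    · refine (((((((h₂ x).const_mul ε).fun_mul (h₃ x)).fun_mul (h₂ x)).fun_add ((h₁ x).fun_mul
        ((h₁ x).fun_neg.fun_mul (h₃ x)))).fun_mul (h₃ x)).fun_add (((h₁ x).fun_mul (h₂ x)).fun_mul
        (((h₁ x).const_mul (-ε * s)).fun_mul (h₂ x)))).congr_deriv ?_
      have h4 := h12 x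
      have h5 := h13 x
      have h6 := e12 x
      clear e12 h12 h13 h₁ h₂ h₃
      generalize X₁ x = u at *
      generalize X₂ x = v at *
      generalize X₃ x = w at *
      norm_num
      grind
    · beta_reduce
      have h4 := h12 x
      have h5 := h13 x
      have h6 := e12 x
      clear e12 h12 h13 h₁ h₂ h₃
      generalize X₁ x = u at *
      generalize X₂ x = v at *
      generalize X₃ x = w at *
      norm_num
      grind
    · simp at h
    · simp at h

/-- The substitution z = X₁² carries the algebraic equation for E to Lamé's equation of degree 2N +
κ₁ + 1 + κ₃. -/
theorem lame_solution {s ε N d : ℝ} {X₁ X₂ X₃ : ℝ → ℝ} (hε : ε ^ 2 = 1)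
    (h₁ : ∀ x, HasDerivAt X₁ (ε * X₂ x * X₃ x) x) (h₂ : ∀ x, HasDerivAt X₂ (-X₁ x * X₃ x) x)
    (h₃ : ∀ x, HasDerivAt X₃ (-ε * s * X₁ x * X₂ x) x) (h12 : ∀ x, X₂ x ^ 2 = ε * (1 - X₁ x ^ 2))
    (h13 : ∀ x, X₃ x ^ 2 = 1 - s * X₁ x ^ 2) (κ₁ κ₃ : Fin 2) {E : ℝ[X]}
    (hE : ∀ z : ℝ, 4 * z * (1 - z) * (1 - s * z) * (derivative (derivative E)).eval z +
        2 * ((2 * κ₁.val + 1) * (1 - z) * (1 - s * z) - 3 * z * (1 - s * z)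
          - (2 * κ₃.val + 1) * s * z * (1 - z)) * (derivative E).eval z =
      (s * (2 * N * (2 * N + 1 + 2 * (κ₁.val + 1 + κ₃.val))) * z + d) * E.eval z) :
    ∃ dy : ℝ → ℝ,
      (∀ x, HasDerivAt (fun x => X₁ x ^ κ₁.val * X₂ x * X₃ x ^ κ₃.val * E.eval (X₁ x ^ 2))
        (dy x) x) ∧
      (∀ x, HasDerivAt dy (-ε * ((κ₁.val + 1) ^ 2 + s * (κ₁.val + κ₃.val) ^ 2 - d
        - (2 * N + (κ₁.val + 1 + κ₃.val)) * (2 * N + (κ₁.val + 1 + κ₃.val) + 1) * s * X₁ x ^ 2) *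
          (X₁ x ^ κ₁.val * X₂ x * X₃ x ^ κ₃.val * E.eval (X₁ x ^ 2))) x) ∧
      (κ₁ = 0 → ∀ x, X₁ x = 0 → dy x = 0) ∧ (κ₃ = 0 → ∀ x, X₃ x = 0 → dy x = 0) := by
  obtain ⟨dG, hG, hdG, hGX, hG1, hG3⟩ := lame_prefactor hε h₁ h₂ h₃ h12 h13 κ₁ κ₃
  set G : ℝ → ℝ := fun x => X₁ x ^ κ₁.val * X₂ x * X₃ x ^ κ₃.val
  have hz : ∀ x, HasDerivAt (fun x => X₁ x ^ 2) (2 * X₁ x * (ε * X₂ x * X₃ x)) x := fun x => by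
    simpa using (h₁ x).fun_pow 2
  have hEz : ∀ (Q : ℝ[X]) x, HasDerivAt (fun x => Q.eval (X₁ x ^ 2))
      ((derivative Q).eval (X₁ x ^ 2) * (2 * X₁ x * (ε * X₂ x * X₃ x))) x := fun Q x =>
    (Q.hasDerivAt _).comp x (hz x)
  refine ⟨fun x => dG x * E.eval (X₁ x ^ 2) + G x * ((derivative E).eval (X₁ x ^ 2) *
    (2 * X₁ x * (ε * X₂ x * X₃ x))), fun x => (hG x).fun_mul (hEz E x), fun x => ?_,
    fun h x hx => by simp [hG1 h x hx, hx], fun h x hx => by simp [hG3 h x hx, hx]⟩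
  refine (((hdG x).fun_mul (hEz E x)).fun_add ((hG x).fun_mul ((hEz (derivative E) x).fun_mul
    (((h₁ x).const_mul 2).fun_mul (((h₂ x).const_mul ε).fun_mul (h₃ x)))))).congr_deriv ?_
  have hE' := hE (X₁ x ^ 2)
  have hGX' := hGX x
  have e12 : ε * X₂ x ^ 2 = 1 - X₁ x ^ 2 := by
    linear_combination ε * h12 x + (1 - X₁ x ^ 2) * hε
  have e13 := h13 x
  change _ = _ * (G x * E.eval (X₁ x ^ 2))
  change _ = _ * G x at hGX'
  change _ * G x * _ + _ + _ = _
  generalize G x = γ at *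
  generalize dG x = dγ at *
  generalize (derivative (derivative E)).eval (X₁ x ^ 2) = E2 at *
  generalize (derivative E).eval (X₁ x ^ 2) = E1 at *
  generalize E.eval (X₁ x ^ 2) = E0 at *
  have f1 : X₂ x ^ 2 * X₃ x ^ 2 = ε * (1 - X₁ x ^ 2) * (1 - s * X₁ x ^ 2) := by
    rw [h12, e13]
  clear h12 h13 h₁ h₂ h₃ hE hGX hG hdG hz hEz hG1 hG3
  generalize X₁ x = u at *
  generalize X₂ x = v at *
  generalize X₃ x = w at *
  linear_combination γ * ε * hE' + 4 * ε * E1 * hGX' + γ * E2 * 4 * u ^ 2 * ε ^ 2 * f1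
    + (4 * u ^ 2 * E2 + 2 * E1) * γ * ε * (1 - u ^ 2) * (1 - s * u ^ 2) * hε
    + 2 * ε ^ 2 * γ * E1 * f1 - 2 * ε * u ^ 2 * γ * E1 * e13 - 2 * ε * s * u ^ 2 * γ * E1 * e12

theorem encard_zeros_eq {L : ℝ} {N : ℕ} {φ y : ℝ → ℝ} {f : Fin N → ℝ}
    (hf : Function.Injective f) (hφ : InjOn φ (Ioo 0 L))
    (hy : ∀ x ∈ Ioo 0 L, y x = 0 ↔ ∃ i, φ x = f i) (hex : ∀ i, ∃ x ∈ Ioo 0 L, φ x = f i) :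
    {x ∈ Ioo 0 L | y x = 0}.encard = N := by
  have himg : φ '' {x ∈ Ioo 0 L | y x = 0} = range f := by
    ext z
    constructor
    · rintro ⟨x, ⟨hx, hyx⟩, rfl⟩
      obtain ⟨i, hi⟩ := (hy x hx).1 hyx
      exact ⟨i, hi.symm⟩
    · rintro ⟨i, rfl⟩
      obtain ⟨x, hx, hxi⟩ := hex i
      exact ⟨x, ⟨hx, (hy x hx).2 ⟨i, hxi⟩⟩, hxi⟩
  rw [← (hφ.mono (sep_subset _ _)).encard_image, himg, ← image_univ, hf.encard_image]
  simp

theorem exists_ne_zero_of_encard_zeros_eq {L : ℝ} (hL : 0 < L) {N : ℕ} {y : ℝ → ℝ}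
    (h : {x ∈ Ioo 0 L | y x = 0}.encard = N) : ∃ x ∈ Icc 0 L, y x ≠ 0 := by
  by_contra! hall
  have hset : {x ∈ Ioo 0 L | y x = 0} = Ioo 0 L :=
    sep_eq_self_iff_mem_true.2 fun x hx => hall x (Ioo_subset_Icc_self hx)
  rw [hset, (Ioo_infinite hL).encard_eq] at h
  exact ENat.top_ne_natCast N h

/-- For constant `r` a `C²` solution of `y'' = -ψ y` is a Sturm–Liouville eigenfunction. -/
theorem hasEigenfunction_const {L R : ℝ} (hL : 0 < L) (hR : 0 < R) {y dy ψ : ℝ → ℝ}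
    (hy : ∀ x, HasDerivAt y (dy x) x) (hdy : ∀ x, HasDerivAt dy (-ψ x * y x) x)
    {κ₀ κL : Fin 2} (h0 : ParityBC κ₀ y dy 0) (hLbc : ParityBC κL y dy L) {j : ℕ}
    (hj : {x ∈ Ioo 0 L | y x = 0}.encard = j) :
    HasEigenfunction L (fun _ => R) (fun x => (R ^ 2)⁻¹ * ψ x) κ₀ κL j := by
  refine ⟨y, dy, ⟨fun x _ => (hy x).hasDerivWithinAt, fun x _ => ?_⟩,
    exists_ne_zero_of_encard_zeros_eq hL hj, h0, hLbc, hj⟩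
  refine (((hdy x).const_mul (1 / R)).congr_deriv ?_).hasDerivWithinAt
  field_simp

/-- The eigenvalues of the problem with constant coefficient `R`, i.e. for a sphere of
radius `R`. -/
theorem exists_sphere_eigenfunctions {k k' R : ℝ} (hk : 0 < k) (hk' : 0 < k')
    (hkk : k' ^ 2 = 1 - k ^ 2) (hR : 0 < R) (κ₁ κ₃ : Fin 2) (m n : ℕ) :
    ∃ h : ℝ, HasEigenfunction (ellipticK k') (fun _ => R)
        (fun x => -h + (R ^ 2)⁻¹ * sphereEigenvalue κ₁ 1 κ₃ m n * jacobiDn x k' ^ 2) κ₃ 1 m ∧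
      HasEigenfunction (ellipticK k) (fun _ => R)
        (fun x => h - (R ^ 2)⁻¹ * sphereEigenvalue κ₁ 1 κ₃ m n * k ^ 2 * jacobiSn x k ^ 2)
        κ₁ 1 n := by
  have hs : k ^ 2 ∈ Ioo (0 : ℝ) 1 := ⟨by positivity, by nlinarith⟩
  have hs' : k' ^ 2 < 1 := by linarith [hs.1]
  obtain ⟨θ, hinj, hθn, hθm, d, hd⟩ := exists_lame_polynomial hs κ₁.val κ₃.val m n
  set E : ℝ[X] := ∏ j, (X - C (θ j)) with hE
  have hroot : ∀ z, E.eval z = 0 ↔ ∃ j, z = θ j := fun z => by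
    simp [hE, eval_prod, Finset.prod_eq_zero_iff, sub_eq_zero]
  -- The separation constant: both equations use the same E, hence the same d.
  set h₀ : ℝ := (κ₁.val + 1) ^ 2 + k ^ 2 * (κ₁.val + κ₃.val) ^ 2 - d with hh
  have hΛ : sphereEigenvalue κ₁ 1 κ₃ m n = (2 * ((n : ℝ) + m) + (κ₁.val + 1 + κ₃.val)) *
      (2 * ((n : ℝ) + m) + (κ₁.val + 1 + κ₃.val) + 1) := by
    simp only [sphereEigenvalue, Fin.val_one]
    push_cast
    ring
  refine ⟨(R ^ 2)⁻¹ * h₀, ?_, ?_⟩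
  · have hL := ellipticK_pos hs'
    have hsq : ∀ x, (jacobiDn x k' / k) ^ 2 = (1 - k' ^ 2 * jacobiSn x k' ^ 2) / k ^ 2 :=
      fun x => by rw [div_pow, jacobiDn_sq hs']
    -- Here X₁² = dn²/k² runs through (1, k⁻²) and meets only the m roots there.
    obtain ⟨dy, hy, hdy, -, hbc⟩ := lame_solution (s := k ^ 2) (ε := -1) (N := (n : ℝ) + m)
      (X₁ := fun x => jacobiDn x k' / k) (X₂ := fun x => k' / k * jacobiCn x k')
      (X₃ := fun x => k' * jacobiSn x k') (by norm_num)
      (fun x => ((hasDerivAt_jacobiDn hs' x).div_const k).congr_deriv (by field_simp))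
      (fun x => ((hasDerivAt_jacobiCn hs' x).const_mul (k' / k)).congr_deriv (by field_simp))
      (fun x => ((hasDerivAt_jacobiSn hs' x).const_mul k').congr_deriv (by field_simp))
      (fun x => by
        rw [hsq, mul_pow, div_pow, jacobiCn_sq]
        field_simp
        linear_combination hkk)
      (fun x => by rw [hsq]; field_simp; ring) κ₁ κ₃ hd
    have hcard : {x ∈ Ioo 0 (ellipticK k') | (jacobiDn x k' / k) ^ κ₁.val *
        (k' / k * jacobiCn x k') * (k' * jacobiSn x k') ^ κ₃.val *
          E.eval ((jacobiDn x k' / k) ^ 2) = 0}.encard = m := by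
      refine encard_zeros_eq (φ := fun x => (jacobiDn x k' / k) ^ 2) (f := fun i => θ (.inr i))
        (hinj.comp Sum.inr_injective) ?_ (fun x hx => ?_) fun i => ?_
      · intro x hx y hy hxy
        simp only [hsq] at hxy
        refine (strictMonoOn_jacobiSn_sq hs').injOn (Ioo_subset_Icc_self hx)
          (Ioo_subset_Icc_self hy) ?_
        have h1 := (div_left_inj' hs.1.ne').1 hxy
        exact mul_left_cancel₀ (pow_pos hk' 2).ne' (by linarith)
      · have hz := jacobiSn_sq_mem_Ioo hs' hx
        have hsn : jacobiSn x k' ≠ 0 := fun h => by rw [h] at hz; norm_num at hz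
        have hcn : jacobiCn x k' ≠ 0 := fun h => by
          have := jacobiCn_sq x k'
          rw [h] at this
          linarith [hz.2]
        have hdn := (jacobiDn_pos hs' x).ne'
        rw [mul_eq_zero, or_iff_right (by positivity), hroot]
        refine ⟨fun ⟨j, hj⟩ => ?_, fun ⟨i, hi⟩ => ⟨_, hi⟩⟩
        rcases j with j | j
        · exfalso
          have h1 := (hθn j).2
          rw [← hj, hsq, div_lt_one hs.1] at h1
          nlinarith [hz.2, pow_pos hk' 2]
        · exact ⟨j, hj⟩
      · obtain ⟨h1, h2⟩ := hθm i
        have h3 : θ (.inr i) * k ^ 2 < 1 := by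
          have := mul_lt_mul_of_pos_right h2 hs.1
          rwa [inv_mul_cancel₀ hs.1.ne'] at this
        obtain ⟨x, hx, hxe⟩ := exists_jacobiSn_sq_eq hs'
          (z := (1 - θ (.inr i) * k ^ 2) / k' ^ 2)
          ⟨div_pos (by linarith) (by positivity), (div_lt_one (by positivity)).2 (by
            nlinarith [hs.1])⟩
        refine ⟨x, hx, ?_⟩
        simp only [hsq, hxe]
        field_simp
        ring
    have := hasEigenfunction_const (R := R) (κ₀ := κ₃) (κL := 1) hL hR hy
      (ψ := fun x => -h₀ + sphereEigenvalue κ₁ 1 κ₃ m n * jacobiDn x k' ^ 2)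
      (fun x => (hdy x).congr_deriv (by
        rw [hΛ, hh]
        field_simp
        ring)) ?_ ?_ hcard
    · convert this using 2
      ring
    · unfold ParityBC
      split_ifs with h
      · exact hbc h 0 (by simp [jacobiSn_zero hs'])
      · have : κ₃ = 1 := by omega
        simp [this, jacobiSn_zero hs']
    · simp [ParityBC, jacobiCn_ellipticK hs']
  · have hL := ellipticK_pos hs.2
    -- Here X₁² = sn² runs through (0, 1) and meets only the n roots there.
    obtain ⟨dy, hy, hdy, hbc, -⟩ := lame_solution (s := k ^ 2) (ε := 1) (N := (n : ℝ) + m)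
      (X₁ := fun x => jacobiSn x k) (X₂ := fun x => jacobiCn x k)
      (X₃ := fun x => jacobiDn x k) (by norm_num)
      (fun x => (hasDerivAt_jacobiSn hs.2 x).congr_deriv (by ring))
      (fun x => hasDerivAt_jacobiCn hs.2 x)
      (fun x => (hasDerivAt_jacobiDn hs.2 x).congr_deriv (by ring))
      (fun x => by rw [jacobiCn_sq, one_mul]) (fun x => jacobiDn_sq hs.2 x) κ₁ κ₃ hd
    have hcard : {x ∈ Ioo 0 (ellipticK k) | jacobiSn x k ^ κ₁.val * jacobiCn x k *
        jacobiDn x k ^ κ₃.val * E.eval (jacobiSn x k ^ 2) = 0}.encard = n := by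
      refine encard_zeros_eq (φ := fun x => jacobiSn x k ^ 2) (f := fun i => θ (.inl i))
        (hinj.comp Sum.inl_injective) ((strictMonoOn_jacobiSn_sq hs.2).injOn.mono
          Ioo_subset_Icc_self) (fun x hx => ?_) fun i => exists_jacobiSn_sq_eq hs.2 (hθn i)
      have hz := jacobiSn_sq_mem_Ioo hs.2 hx
      have hsn : jacobiSn x k ≠ 0 := fun h => by rw [h] at hz; norm_num at hz
      have hcn : jacobiCn x k ≠ 0 := fun h => by
        have := jacobiCn_sq x k
        rw [h] at this
        linarith [hz.2]
      have hdn := (jacobiDn_pos hs.2 x).ne'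
      rw [mul_eq_zero, or_iff_right (by positivity), hroot]
      refine ⟨fun ⟨j, hj⟩ => ?_, fun ⟨i, hi⟩ => ⟨_, hi⟩⟩
      rcases j with j | j
      · exact ⟨j, hj⟩
      · exfalso
        have h1 := (hθm j).1
        rw [← hj] at h1
        linarith [hz.2]
    have := hasEigenfunction_const (R := R) (κ₀ := κ₁) (κL := 1) hL hR hy
      (ψ := fun x => h₀ - sphereEigenvalue κ₁ 1 κ₃ m n * k ^ 2 * jacobiSn x k ^ 2)
      (fun x => (hdy x).congr_deriv (by rw [hΛ, hh]; ring)) ?_ ?_ hcard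
    · convert this using 2
      ring
    · unfold ParityBC
      split_ifs with h
      · exact hbc h 0 (by simp [jacobiSn_zero hs.2])
      · have : κ₁ = 1 := by omega
        simp [this, jacobiSn_zero hs.2]
    · simp [ParityBC, jacobiCn_ellipticK hs.2]

end Lame

/-! ### Coupled pairs: comparison, uniqueness and existence. -/

/-- Raising the coefficient `r` and the potential raises the Prüfer angle, if the smaller problem
has a nonincreasing potential and a Dirichlet condition at the right end. -/
theorem IsPruferAngle.lt_of_coeff_le {L : ℝ} (hL : 0 < L) {r r' g g' θ θ' : ℝ → ℝ}
    (hr : Continuous r) (hr0 : ∀ x, 0 < r x) (hr' : Continuous r') (hrr : ∀ x, r x ≤ r' x)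
    (hrL : r L < r' L) (hg : Continuous g) (hg' : Continuous g') (hanti : AntitoneOn g (Icc 0 L))
    (hgg : ∀ x ∈ Icc 0 L, g x ≤ g' x) (h : IsPruferAngle 0 L r g θ)
    (h' : IsPruferAngle 0 L r' g' θ') (h0 : θ 0 ≤ θ' 0) (hsin : Real.sin (θ L) = 0) :
    θ L < θ' L := by
  -- Nonnegative energy makes θ a subsolution of the larger problem; equality at L, where the sine
  -- vanishes, would give r L = r' L.
  have hc := prufer_comparison hr' hg' h h' (fun x hx => by
    have hE := h.energy_nonneg hr hr0 hg hanti hsin hx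
    refine (mul_le_mul_of_nonneg_right (hrr x) hE).trans ?_
    have := hgg x hx
    have := (hr0 x).le.trans (hrr x)
    unfold pruferField
    gcongr) (fun x _ => le_rfl) h0
  by_contra! hb
  have h1 := (hc.2 hL hb L (right_mem_Icc.2 hL.le)).2.1
  rw [pruferField_of_sin_eq_zero hsin, pruferField_of_sin_eq_zero hsin] at h1
  exact hrL.ne h1

/-- A pair of Prüfer angles, with prescribed boundary values, of two equations coupled through the
parameters `lam` and `h`. -/
def IsCoupledPair (L₁ L₂ : ℝ) (r₁ r₂ W₁ W₂ : ℝ → ℝ) (κ₁ κ₂ κ₃ : Fin 2) (m n : ℕ)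
    (lam h : ℝ) : Prop :=
  (∃ θ, IsPruferAngle 0 L₁ r₁ (fun x => -h + lam * W₁ x) θ ∧ θ 0 = startAngle κ₃ ∧
    θ L₁ = targetAngle κ₂ m) ∧
  ∃ θ, IsPruferAngle 0 L₂ r₂ (fun x => h + lam * W₂ x) θ ∧ θ 0 = startAngle κ₁ ∧
    θ L₂ = targetAngle κ₂ n

/-- Both increments of the potentials are nonincreasing in x, hence smallest at the right end, and
those end values add up to 0. So one of them is nonnegative. -/
theorem potential_le_or_le {L₁ L₂ : ℝ} {W₁ W₂ : ℝ → ℝ} (hW₁ : StrictAntiOn W₁ (Icc 0 L₁))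
    (hW₂ : StrictAntiOn W₂ (Icc 0 L₂)) (hW : W₁ L₁ + W₂ L₂ = 0) (hL₁ : 0 < L₁) (hL₂ : 0 < L₂)
    {lam lam' : ℝ} (hlam : lam ≤ lam') (h h' : ℝ) :
    ((∀ x ∈ Icc 0 L₁, -h + lam * W₁ x ≤ -h' + lam' * W₁ x) ∧
      (lam < lam' → ∀ x ∈ Ioo 0 L₁, -h + lam * W₁ x < -h' + lam' * W₁ x)) ∨
    ((∀ x ∈ Icc 0 L₂, h + lam * W₂ x ≤ h' + lam' * W₂ x) ∧
      (lam < lam' → ∀ x ∈ Ioo 0 L₂, h + lam * W₂ x < h' + lam' * W₂ x)) := by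
  have hd := sub_nonneg.2 hlam
  rcases le_total (h' - h) ((lam' - lam) * W₁ L₁) with hle | hle
  · left
    refine ⟨fun x hx => ?_, fun hlt x hx => ?_⟩
    · have h1 := hW₁.antitoneOn hx (right_mem_Icc.2 hL₁.le) hx.2
      have h2 := mul_le_mul_of_nonneg_left h1 hd
      linarith
    · have h1 := hW₁ (Ioo_subset_Icc_self hx) (right_mem_Icc.2 hL₁.le) hx.2
      have h2 := mul_lt_mul_of_pos_left h1 (sub_pos.2 hlt)
      linarith
  · right
    rw [show W₁ L₁ = -W₂ L₂ by linarith] at hle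
    refine ⟨fun x hx => ?_, fun hlt x hx => ?_⟩
    · have h1 := hW₂.antitoneOn hx (right_mem_Icc.2 hL₂.le) hx.2
      have h2 := mul_le_mul_of_nonneg_left h1 hd
      linarith
    · have h1 := hW₂ (Ioo_subset_Icc_self hx) (right_mem_Icc.2 hL₂.le) hx.2
      have h2 := mul_lt_mul_of_pos_left h1 (sub_pos.2 hlt)
      linarith

/-- If lam < lam', one potential increases, and the corresponding angle would overshoot its smaller
or equal target. It yields uniqueness as well as the comparison of Neumann with Dirichlet problems.
-/
theorem IsCoupledPair.le_of_target_le {L₁ L₂ : ℝ} {r₁ r₂ W₁ W₂ : ℝ → ℝ} (hL₁ : 0 < L₁)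
    (hL₂ : 0 < L₂) (hr₁ : Continuous r₁) (hr₁0 : ∀ x, 0 < r₁ x) (hr₂ : Continuous r₂)
    (hr₂0 : ∀ x, 0 < r₂ x) (hW₁c : Continuous W₁) (hW₂c : Continuous W₂)
    (hW₁ : StrictAntiOn W₁ (Icc 0 L₁)) (hW₂ : StrictAntiOn W₂ (Icc 0 L₂))
    (hW : W₁ L₁ + W₂ L₂ = 0) {κ₁ κ₂ κ₂' κ₃ : Fin 2} {m n m' n' : ℕ} {lam lam' h h' : ℝ}
    (hp : IsCoupledPair L₁ L₂ r₁ r₂ W₁ W₂ κ₁ κ₂ κ₃ m n lam h)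
    (hp' : IsCoupledPair L₁ L₂ r₁ r₂ W₁ W₂ κ₁ κ₂' κ₃ m' n' lam' h')
    (hm : targetAngle κ₂' m' ≤ targetAngle κ₂ m) (hn : targetAngle κ₂' n' ≤ targetAngle κ₂ n) :
    lam' ≤ lam := by
  obtain ⟨⟨θ, hθ, hθ0, hθL⟩, φ, hφ, hφ0, hφL⟩ := hp
  obtain ⟨⟨θ', hθ', hθ0', hθL'⟩, φ', hφ', hφ0', hφL'⟩ := hp'
  by_contra! hlt
  rcases potential_le_or_le hW₁ hW₂ hW hL₁ hL₂ hlt.le h h' with ⟨h1, h2⟩ | ⟨h1, h2⟩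
  · have := hθ.lt_of_potential_lt hL₁ hr₁ hr₁0 (by fun_prop) hθ' h1 (h2 hlt)
      (by rw [hθ0, hθ0'])
    linarith
  · have := hφ.lt_of_potential_lt hL₂ hr₂ hr₂0 (by fun_prop) hφ' h1 (h2 hlt)
      (by rw [hφ0, hφ0'])
    linarith

/-- If lam ≤ lam', one equation has both a larger coefficient and a larger potential, so its angle
overshoots. The condition 0 ≤ lam makes the smaller problem's potentials nonincreasing. Only that
problem must be Dirichlet, the Dirichlet target being the larger one. -/
theorem IsCoupledPair.lt_of_coeff_le {L₁ L₂ : ℝ} {r₁ r₂ r₁' r₂' W₁ W₂ : ℝ → ℝ} (hL₁ : 0 < L₁)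
    (hL₂ : 0 < L₂) (hr₁ : Continuous r₁) (hr₁0 : ∀ x, 0 < r₁ x) (hr₂ : Continuous r₂)
    (hr₂0 : ∀ x, 0 < r₂ x) (hr₁' : Continuous r₁') (hr₂' : Continuous r₂')
    (hle₁ : ∀ x, r₁ x ≤ r₁' x) (hle₂ : ∀ x, r₂ x ≤ r₂' x) (hlt₁ : r₁ L₁ < r₁' L₁)
    (hlt₂ : r₂ L₂ < r₂' L₂) (hW₁c : Continuous W₁) (hW₂c : Continuous W₂)
    (hW₁ : StrictAntiOn W₁ (Icc 0 L₁)) (hW₂ : StrictAntiOn W₂ (Icc 0 L₂))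
    (hW : W₁ L₁ + W₂ L₂ = 0) {κ₁ κ₂ κ₃ : Fin 2} {m n : ℕ} {lam lam' h h' : ℝ} (hlam : 0 ≤ lam)
    (hp : IsCoupledPair L₁ L₂ r₁ r₂ W₁ W₂ κ₁ 1 κ₃ m n lam h)
    (hp' : IsCoupledPair L₁ L₂ r₁' r₂' W₁ W₂ κ₁ κ₂ κ₃ m n lam' h') :
    lam' < lam := by
  obtain ⟨⟨θ, hθ, hθ0, hθL⟩, φ, hφ, hφ0, hφL⟩ := hp
  obtain ⟨⟨θ', hθ', hθ0', hθL'⟩, φ', hφ', hφ0', hφL'⟩ := hp'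
  by_contra! hle
  have hanti : ∀ {L : ℝ} {W : ℝ → ℝ} (d : ℝ), StrictAntiOn W (Icc 0 L) →
      AntitoneOn (fun x => d + lam * W x) (Icc 0 L) := fun d hWa x hx y hy hxy =>
    add_le_add_right (mul_le_mul_of_nonneg_left (hWa.antitoneOn hx hy hxy) hlam) _
  rcases potential_le_or_le hW₁ hW₂ hW hL₁ hL₂ hle h h' with ⟨h1, -⟩ | ⟨h1, -⟩
  · have := hθ.lt_of_coeff_le hL₁ hr₁ hr₁0 hr₁' hle₁ hlt₁ (by fun_prop) (by fun_prop)
      (hanti _ hW₁) h1 hθ' (by rw [hθ0, hθ0']) (by rw [hθL, sin_targetAngle_one])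
    linarith [targetAngle_le_one κ₂ m]
  · have := hφ.lt_of_coeff_le hL₂ hr₂ hr₂0 hr₂' hle₂ hlt₂ (by fun_prop) (by fun_prop)
      (hanti _ hW₂) h1 hφ' (by rw [hφ0, hφ0']) (by rw [hφL, sin_targetAngle_one])
    linarith [targetAngle_le_one κ₂ n]

/-- The eigencurves are Lipschitz continuous, start at a nonnegative height and eventually lie
below the line of slope `-W L`. -/
theorem exists_eigencurve {L : ℝ} (hL : 0 < L) {r W : ℝ → ℝ} (hr : Continuous r) {r₀ : ℝ}
    (hr₀ : 0 < r₀) (hrr : ∀ x, r₀ ≤ r x) (hWc : Continuous W) (hW : StrictAntiOn W (Icc 0 L))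
    (κ₀ κL : Fin 2) (j : ℕ) :
    ∃ M : ℝ → ℝ, Continuous M ∧ 0 ≤ M 0 ∧ (∀ᶠ lam in Filter.atTop, M lam ≤ -(lam * W L)) ∧
      ∀ lam, ∃ θ, IsPruferAngle 0 L r (fun x => lam * W x + M lam) θ ∧ θ 0 = startAngle κ₀ ∧
        θ L = targetAngle κL j := by
  have hr0 : ∀ x, 0 < r x := fun x => hr₀.trans_le (hrr x)
  have hT := pi_div_two_le_targetAngle κL j
  choose M θ hθ hθ0 hθL using fun lam : ℝ => exists_shift_pruferAngle_eq hL hr hr₀ hrr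
    (g := fun x => lam * W x) (by fun_prop) (startAngle_nonneg κ₀) (startAngle_le κ₀) hT
  have hnot : ∀ (lam : ℝ) (g φ : ℝ → ℝ), Continuous g → IsPruferAngle 0 L r g φ →
      φ 0 = startAngle κ₀ → (∀ x ∈ Icc 0 L, g x < lam * W x + M lam) →
      φ L < targetAngle κL j := fun lam g φ hg hφ hφ0 hlt => by
    rw [← hθL lam]
    exact hφ.lt_of_potential_lt hL hr hr0 (by fun_prop) (hθ lam) (fun x hx => (hlt x hx).le)
      (fun x hx => hlt x (Ioo_subset_Icc_self hx)) (by rw [hφ0, hθ0])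
  refine ⟨M, ?_, ?_, ?_, fun lam => ⟨θ lam, hθ lam, hθ0 lam, hθL lam⟩⟩
  · obtain ⟨C, hC⟩ := (isCompact_Icc (a := 0) (b := L)).bddAbove_image
      (f := fun x => |W x|) (by fun_prop)
    have hC' : ∀ x ∈ Icc 0 L, |W x| ≤ C := fun x hx => hC (mem_image_of_mem _ hx)
    refine (LipschitzWith.of_le_add_mul C.toNNReal fun lam lam' => ?_).continuous
    by_contra! hlt
    refine (hnot lam _ _ (by fun_prop) (hθ lam') (hθ0 lam') fun x hx => ?_).ne (hθL lam')
    have h1 : (lam' - lam) * W x ≤ C.toNNReal * dist lam lam' := by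
      refine (le_abs_self _).trans ?_
      rw [abs_mul, mul_comm, Real.dist_eq, abs_sub_comm lam lam']
      exact mul_le_mul_of_nonneg_right ((hC' x hx).trans (Real.le_coe_toNNReal C)) (abs_nonneg _)
    linarith
  -- For the potential 0 the angle stays below π/2, so a negative M 0 could not reach the target.
  · by_contra! hlt
    obtain ⟨φ, hφ0, hφ⟩ := exists_isPruferAngle hL.le hr (g := fun _ => 0) (by fun_prop)
      (startAngle κ₀)
    have h1 := (hθ 0).lt_of_potential_lt hL hr hr0 (by fun_prop) hφ
      (fun x _ => by linarith) (fun x _ => by linarith) (by rw [hφ0, hθ0])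
    have h2 := hφ.le_pi_div_two hL.le hr hr0 (by fun_prop) (fun x _ => le_rfl)
      (hφ0.trans_le (startAngle_le κ₀))
    rw [hθL] at h1
    linarith
  · obtain ⟨G, hG0, hG⟩ := exists_le_pruferAngle (targetAngle κL j) hr₀ (half_pos hL)
    have hδ : 0 < W (L / 2) - W L := sub_pos.2
      (hW ⟨by linarith, by linarith⟩ (right_mem_Icc.2 hL.le) (by linarith))
    filter_upwards [Filter.eventually_ge_atTop (G / (W (L / 2) - W L))] with lam hlam
    have hlam0 : 0 ≤ lam := (div_nonneg hG0 hδ.le).trans hlam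
    by_contra! hlt
    -- This potential is nonnegative, and at least G on [0, L/2] by the choice of lam, so its angle
    -- already reaches the target.
    have hc : Continuous fun x => lam * (W x - W L) := by fun_prop
    obtain ⟨φ, hφ0, hφ⟩ := exists_isPruferAngle hL.le hr hc (startAngle κ₀)
    refine (hnot lam _ φ hc hφ hφ0 fun x hx => by linarith).not_ge ?_
    refine hG L r _ φ (by linarith) hr hc hrr (fun x hx => ?_) (fun x hx => ?_) hφ
      (by rw [hφ0]; exact startAngle_nonneg κ₀)
    · refine ((div_le_iff₀ hδ).1 hlam).trans (mul_le_mul_of_nonneg_left ?_ hlam0)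
      have := hW.antitoneOn ⟨hx.1, by linarith [hx.2]⟩ ⟨by linarith, by linarith⟩ hx.2
      linarith
    · exact mul_nonneg hlam0
        (sub_nonneg.2 (hW.antitoneOn hx (right_mem_Icc.2 hL.le) hx.2))

/-- M₁ + M₂ is nonnegative at 0 and, by the coupling of the end values, nonpositive for large lam. A
zero of the sum gives the pair with h = M₂ = -M₁. -/
theorem exists_isCoupledPair {L₁ L₂ : ℝ} {r₁ r₂ W₁ W₂ : ℝ → ℝ} {r₀ : ℝ} (hr₀ : 0 < r₀)
    (hL₁ : 0 < L₁) (hL₂ : 0 < L₂) (hr₁ : Continuous r₁) (hr₁0 : ∀ x, r₀ ≤ r₁ x)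
    (hr₂ : Continuous r₂) (hr₂0 : ∀ x, r₀ ≤ r₂ x) (hW₁c : Continuous W₁) (hW₂c : Continuous W₂)
    (hW₁ : StrictAntiOn W₁ (Icc 0 L₁)) (hW₂ : StrictAntiOn W₂ (Icc 0 L₂))
    (hW : W₁ L₁ + W₂ L₂ = 0) (κ₁ κ₂ κ₃ : Fin 2) (m n : ℕ) :
    ∃ lam h, 0 ≤ lam ∧ IsCoupledPair L₁ L₂ r₁ r₂ W₁ W₂ κ₁ κ₂ κ₃ m n lam h := by
  obtain ⟨M₁, hc₁, h0₁, htop₁, hM₁⟩ := exists_eigencurve hL₁ hr₁ hr₀ hr₁0 hW₁c hW₁ κ₃ κ₂ m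
  obtain ⟨M₂, hc₂, h0₂, htop₂, hM₂⟩ := exists_eigencurve hL₂ hr₂ hr₀ hr₂0 hW₂c hW₂ κ₁ κ₂ n
  obtain ⟨B, ⟨hB₁, hB₂⟩, hB0⟩ :=
    ((htop₁.and htop₂).and (Filter.eventually_ge_atTop (0 : ℝ))).exists
  obtain ⟨lam, hlam, h0⟩ := intermediate_value_Icc' hB0
    (f := fun lam => M₁ lam + M₂ lam) (by fun_prop)
    (show (0 : ℝ) ∈ Icc (M₁ B + M₂ B) (M₁ 0 + M₂ 0) from ⟨by
      have : B * W₁ L₁ + B * W₂ L₂ = 0 := by rw [← mul_add, hW, mul_zero]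
      linarith, by linarith⟩)
  refine ⟨lam, M₂ lam, hlam.1, ?_, ?_⟩
  · obtain ⟨θ, hθ, h1⟩ := hM₁ lam
    refine ⟨θ, ?_, h1⟩
    convert hθ using 2
    simp only at h0
    linarith
  · obtain ⟨θ, hθ, h1⟩ := hM₂ lam
    refine ⟨θ, ?_, h1⟩
    convert hθ using 2
    ring

/-! ### Application to the ellipsoid. -/

section Ellipsoid

variable {a b c : ℝ}

theorem strictAntiOn_jacobiDn_sq (hab : b < a) (hbc : c < b) (hc : 0 < c) :
    StrictAntiOn (fun s => jacobiDn s (coModulus a b c) ^ 2)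
      (Icc 0 (ellipticK (coModulus a b c))) := fun x hx y hy hxy => by
  have hk := coModulus_sq_lt_one hab hbc hc
  have h1 := mul_lt_mul_of_pos_left (strictMonoOn_jacobiSn_sq hk hx hy hxy)
    (pow_pos (coModulus_pos hab hbc hc) 2)
  simp only [jacobiDn_sq hk]
  linarith

theorem strictAntiOn_neg_jacobiSn_sq (hab : b < a) (hbc : c < b) (hc : 0 < c) :
    StrictAntiOn (fun t => -(modulus a b c ^ 2 * jacobiSn t (modulus a b c) ^ 2))
      (Icc 0 (ellipticK (modulus a b c))) := fun x hx y hy hxy => by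
  have hk := modulus_sq_mem hab hbc hc
  have h1 := mul_lt_mul_of_pos_left (strictMonoOn_jacobiSn_sq hk.2 hx hy hxy) hk.1
  simp only
  linarith

/-- Both terms are ±k², since dn²(K', k') = 1 - k'² = k². -/
theorem coupling_at_ellipticK (hab : b < a) (hbc : c < b) (hc : 0 < c) :
    jacobiDn (ellipticK (coModulus a b c)) (coModulus a b c) ^ 2 +
      -(modulus a b c ^ 2 * jacobiSn (ellipticK (modulus a b c)) (modulus a b c) ^ 2) = 0 := by
  have hk := modulus_sq_mem hab hbc hc
  have hk' := coModulus_sq_lt_one hab hbc hc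
  rw [jacobiDn_sq hk', jacobiSn_ellipticK hk', jacobiSn_ellipticK hk.2, coModulus_sq hab hbc hc]
  ring

theorem continuous_jacobiDn_sq (hab : b < a) (hbc : c < b) (hc : 0 < c) :
    Continuous fun s => jacobiDn s (coModulus a b c) ^ 2 :=
  (continuous_jacobiDn (coModulus_sq_lt_one hab hbc hc)).pow 2

theorem continuous_neg_jacobiSn_sq (hab : b < a) (hbc : c < b) (hc : 0 < c) :
    Continuous fun t => -(modulus a b c ^ 2 * jacobiSn t (modulus a b c) ^ 2) :=
  (((continuous_jacobiSn (modulus_sq_mem hab hbc hc).2).pow 2).const_mul _).neg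

/-- The pairs of Prüfer angles for the ellipsoid with the coefficients `r₁`, `r₂`. -/
def IsEllipsoidPair (a b c : ℝ) (r₁ r₂ : ℝ → ℝ) (κ₁ κ₂ κ₃ : Fin 2) (m n : ℕ)
    (lam h : ℝ) : Prop :=
  IsCoupledPair (ellipticK (coModulus a b c)) (ellipticK (modulus a b c)) r₁ r₂
    (fun s => jacobiDn s (coModulus a b c) ^ 2)
    (fun t => -(modulus a b c ^ 2 * jacobiSn t (modulus a b c) ^ 2)) κ₁ κ₂ κ₃ m n lam h

theorem isEllipsoidPair_iff (hab : b < a) (hbc : c < b) (hc : 0 < c) {r₁ r₂ : ℝ → ℝ}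
    (hr₁ : Continuous r₁) (hr₁0 : ∀ x, 0 < r₁ x) (hr₂ : Continuous r₂) (hr₂0 : ∀ x, 0 < r₂ x)
    {κ₁ κ₂ κ₃ : Fin 2} {m n : ℕ} {lam h : ℝ} :
    IsEllipsoidPair a b c r₁ r₂ κ₁ κ₂ κ₃ m n lam h ↔
      HasEigenfunction (ellipticK (coModulus a b c)) r₁
        (fun s => -h + lam * jacobiDn s (coModulus a b c) ^ 2) κ₃ κ₂ m ∧
      HasEigenfunction (ellipticK (modulus a b c)) r₂
        (fun t => h - lam * modulus a b c ^ 2 * jacobiSn t (modulus a b c) ^ 2) κ₁ κ₂ n := by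
  have hk := (modulus_sq_mem hab hbc hc).2
  have hk' := coModulus_sq_lt_one hab hbc hc
  have hg : (fun t => h - lam * modulus a b c ^ 2 * jacobiSn t (modulus a b c) ^ 2) =
      fun t => h + lam * -(modulus a b c ^ 2 * jacobiSn t (modulus a b c) ^ 2) := by
    ext t
    ring
  have h1 := continuous_jacobiDn_sq hab hbc hc
  have h2 := continuous_neg_jacobiSn_sq hab hbc hc
  rw [hg, hasEigenfunction_iff (ellipticK_pos hk') hr₁ hr₁0 (by fun_prop),
    hasEigenfunction_iff (ellipticK_pos hk) hr₂ hr₂0 (by fun_prop)]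
  rfl

theorem exists_isEllipsoidPair_sphere (hab : b < a) (hbc : c < b) (hc : 0 < c) {R : ℝ}
    (hR : 0 < R) (κ₁ κ₃ : Fin 2) (m n : ℕ) :
    ∃ h, IsEllipsoidPair a b c (fun _ => R) (fun _ => R) κ₁ 1 κ₃ m n
      ((R ^ 2)⁻¹ * sphereEigenvalue κ₁ 1 κ₃ m n) h := by
  obtain ⟨h, h1⟩ := exists_sphere_eigenfunctions (modulus_pos hab hbc hc)
    (coModulus_pos hab hbc hc) (coModulus_sq hab hbc hc) hR κ₁ κ₃ m n
  exact ⟨h, (isEllipsoidPair_iff hab hbc hc continuous_const (fun _ => hR) continuous_const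
    fun _ => hR).2 h1⟩

theorem IsEllipsoidPair.lt_of_coeff_le (hab : b < a) (hbc : c < b) (hc : 0 < c)
    {r₁ r₂ r₁' r₂' : ℝ → ℝ} (hr₁ : Continuous r₁) (hr₁0 : ∀ x, 0 < r₁ x) (hr₂ : Continuous r₂)
    (hr₂0 : ∀ x, 0 < r₂ x) (hr₁' : Continuous r₁') (hr₂' : Continuous r₂')
    (hle₁ : ∀ x, r₁ x ≤ r₁' x) (hle₂ : ∀ x, r₂ x ≤ r₂' x)
    (hlt₁ : r₁ (ellipticK (coModulus a b c)) < r₁' (ellipticK (coModulus a b c)))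
    (hlt₂ : r₂ (ellipticK (modulus a b c)) < r₂' (ellipticK (modulus a b c)))
    {κ₁ κ₂ κ₃ : Fin 2} {m n : ℕ} {lam lam' h h' : ℝ} (hlam : 0 ≤ lam)
    (hp : IsEllipsoidPair a b c r₁ r₂ κ₁ 1 κ₃ m n lam h)
    (hp' : IsEllipsoidPair a b c r₁' r₂' κ₁ κ₂ κ₃ m n lam' h') : lam' < lam :=
  IsCoupledPair.lt_of_coeff_le (ellipticK_pos (coModulus_sq_lt_one hab hbc hc))
    (ellipticK_pos (modulus_sq_mem hab hbc hc).2) hr₁ hr₁0 hr₂ hr₂0 hr₁' hr₂' hle₁ hle₂ hlt₁ hlt₂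
    (continuous_jacobiDn_sq hab hbc hc) (continuous_neg_jacobiSn_sq hab hbc hc)
    (strictAntiOn_jacobiDn_sq hab hbc hc) (strictAntiOn_neg_jacobiSn_sq hab hbc hc)
    (coupling_at_ellipticK hab hbc hc) hlam hp hp'

theorem isEllipsoidEigenvalue_iff (hab : b < a) (hbc : c < b) (hc : 0 < c)
    {κ₁ κ₂ κ₃ : Fin 2} {m n : ℕ} {lam : ℝ} :
    IsEllipsoidEigenvalue a b c κ₁ κ₂ κ₃ m n lam ↔
      ∃ h, IsEllipsoidPair a b c (pCoeff a b c) (qCoeff a b c) κ₁ κ₂ κ₃ m n lam h :=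
  exists_congr fun _ => (isEllipsoidPair_iff hab hbc hc (continuous_pCoeff hab hbc hc)
    (fun x => hc.trans_le (le_pCoeff hbc hc x)) (continuous_qCoeff hab hbc hc)
    fun x => (hc.trans hbc).trans_le (le_qCoeff hab (hc.trans hbc) x)).symm

theorem exists_isEllipsoidEigenvalue (hab : b < a) (hbc : c < b) (hc : 0 < c)
    (κ₁ κ₂ κ₃ : Fin 2) (m n : ℕ) :
    ∃ lam, 0 ≤ lam ∧ IsEllipsoidEigenvalue a b c κ₁ κ₂ κ₃ m n lam := by
  obtain ⟨lam, h, hlam, hp⟩ := exists_isCoupledPair hc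
    (ellipticK_pos (coModulus_sq_lt_one hab hbc hc)) (ellipticK_pos (modulus_sq_mem hab hbc hc).2)
    (continuous_pCoeff hab hbc hc) (le_pCoeff hbc hc) (continuous_qCoeff hab hbc hc)
    (fun x => hbc.le.trans (le_qCoeff hab (hc.trans hbc) x))
    (continuous_jacobiDn_sq hab hbc hc) (continuous_neg_jacobiSn_sq hab hbc hc)
    (strictAntiOn_jacobiDn_sq hab hbc hc) (strictAntiOn_neg_jacobiSn_sq hab hbc hc)
    (coupling_at_ellipticK hab hbc hc) κ₁ κ₂ κ₃ m n
  exact ⟨lam, hlam, (isEllipsoidEigenvalue_iff hab hbc hc).2 ⟨h, hp⟩⟩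

theorem IsEllipsoidEigenvalue.le_of_target_le (hab : b < a) (hbc : c < b) (hc : 0 < c)
    {κ₁ κ₂ κ₂' κ₃ : Fin 2} {m n m' n' : ℕ} {lam lam' : ℝ}
    (hp : IsEllipsoidEigenvalue a b c κ₁ κ₂ κ₃ m n lam)
    (hp' : IsEllipsoidEigenvalue a b c κ₁ κ₂' κ₃ m' n' lam')
    (hm : targetAngle κ₂' m' ≤ targetAngle κ₂ m) (hn : targetAngle κ₂' n' ≤ targetAngle κ₂ n) :
    lam' ≤ lam := by
  obtain ⟨h, hp⟩ := (isEllipsoidEigenvalue_iff hab hbc hc).1 hp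
  obtain ⟨h', hp'⟩ := (isEllipsoidEigenvalue_iff hab hbc hc).1 hp'
  exact IsCoupledPair.le_of_target_le (ellipticK_pos (coModulus_sq_lt_one hab hbc hc))
    (ellipticK_pos (modulus_sq_mem hab hbc hc).2) (continuous_pCoeff hab hbc hc)
    (fun x => hc.trans_le (le_pCoeff hbc hc x)) (continuous_qCoeff hab hbc hc)
    (fun x => (hc.trans hbc).trans_le (le_qCoeff hab (hc.trans hbc) x))
    (continuous_jacobiDn_sq hab hbc hc) (continuous_neg_jacobiSn_sq hab hbc hc)
    (strictAntiOn_jacobiDn_sq hab hbc hc) (strictAntiOn_neg_jacobiSn_sq hab hbc hc)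
    (coupling_at_ellipticK hab hbc hc) hp hp' hm hn

theorem IsEllipsoidEigenvalue.unique (hab : b < a) (hbc : c < b) (hc : 0 < c)
    {κ₁ κ₂ κ₃ : Fin 2} {m n : ℕ} {lam lam' : ℝ}
    (hp : IsEllipsoidEigenvalue a b c κ₁ κ₂ κ₃ m n lam)
    (hp' : IsEllipsoidEigenvalue a b c κ₁ κ₂ κ₃ m n lam') : lam = lam' :=
  le_antisymm (hp'.le_of_target_le hab hbc hc hp le_rfl le_rfl)
    (hp.le_of_target_le hab hbc hc hp' le_rfl le_rfl)

/-- The sphere of radius c has the smaller coefficients and is Dirichlet, so κ₂ is arbitrary for the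
ellipsoid. -/
theorem IsEllipsoidEigenvalue.lt_sphereEigenvalue (hab : b < a) (hbc : c < b) (hc : 0 < c)
    {κ₁ κ₂ κ₃ : Fin 2} {m n : ℕ} {lam : ℝ}
    (hp : IsEllipsoidEigenvalue a b c κ₁ κ₂ κ₃ m n lam) :
    lam < (c ^ 2)⁻¹ * sphereEigenvalue κ₁ 1 κ₃ m n := by
  obtain ⟨h, hp⟩ := (isEllipsoidEigenvalue_iff hab hbc hc).1 hp
  obtain ⟨h', hs⟩ := exists_isEllipsoidPair_sphere hab hbc hc hc κ₁ κ₃ m n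
  have hΛ : 0 ≤ sphereEigenvalue κ₁ 1 κ₃ m n := by unfold sphereEigenvalue; positivity
  exact IsEllipsoidPair.lt_of_coeff_le hab hbc hc continuous_const (fun _ => hc) continuous_const
    (fun _ => hc) (continuous_pCoeff hab hbc hc) (continuous_qCoeff hab hbc hc)
    (le_pCoeff hbc hc) (fun x => hbc.le.trans (le_qCoeff hab (hc.trans hbc) x))
    (by rw [pCoeff_ellipticK hab hbc hc]; exact hbc)
    (by rw [qCoeff_ellipticK hab hbc hc]; exact hbc) (by positivity) hs hp

/-- Now the ellipsoid has the smaller coefficients, compared with the sphere of radius a, so it must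
be the Dirichlet problem. -/
theorem IsEllipsoidEigenvalue.sphereEigenvalue_lt (hab : b < a) (hbc : c < b) (hc : 0 < c)
    {κ₁ κ₃ : Fin 2} {m n : ℕ} {lam : ℝ} (hp : IsEllipsoidEigenvalue a b c κ₁ 1 κ₃ m n lam) :
    (a ^ 2)⁻¹ * sphereEigenvalue κ₁ 1 κ₃ m n < lam := by
  have hb := hc.trans hbc
  -- Uniqueness identifies lam with the nonnegative value from the existence proof.
  have hlam : 0 ≤ lam := by
    obtain ⟨lam', h0, hp'⟩ := exists_isEllipsoidEigenvalue hab hbc hc κ₁ 1 κ₃ m n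
    rwa [hp.unique hab hbc hc hp']
  obtain ⟨h, hp⟩ := (isEllipsoidEigenvalue_iff hab hbc hc).1 hp
  obtain ⟨h', hs⟩ := exists_isEllipsoidPair_sphere hab hbc hc (hb.trans hab) κ₁ κ₃ m n
  exact IsEllipsoidPair.lt_of_coeff_le hab hbc hc (continuous_pCoeff hab hbc hc)
    (fun x => hc.trans_le (le_pCoeff hbc hc x)) (continuous_qCoeff hab hbc hc)
    (fun x => hb.trans_le (le_qCoeff hab hb x)) continuous_const continuous_const
    (fun x => (pCoeff_le hbc hc x).trans hab.le) (qCoeff_le hab hb)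
    (by rw [pCoeff_ellipticK hab hbc hc]; exact hab)
    (by rw [qCoeff_ellipticK hab hbc hc]; exact hab) hlam hp hs

end Ellipsoid

theorem mainTheorem4 (a b c : ℝ) (hab : b < a) (hbc : c < b) (hc : 0 < c)
    (κ₁ κ₂ κ₃ : Fin 2) (m n : ℕ) :
    (∃! lam : ℝ, IsEllipsoidEigenvalue a b c κ₁ κ₂ κ₃ m n lam) ∧
    ∀ lam : ℝ, IsEllipsoidEigenvalue a b c κ₁ κ₂ κ₃ m n lam →
      (κ₂ = 1 →
        (a ^ 2)⁻¹ * sphereEigenvalue κ₁ κ₂ κ₃ m n < lam ∧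
        lam < (c ^ 2)⁻¹ * sphereEigenvalue κ₁ κ₂ κ₃ m n) ∧
      (κ₂ = 0 →
        lam < (c ^ 2)⁻¹ * sphereEigenvalue κ₁ 1 κ₃ m n) ∧
      (κ₂ = 0 → 1 ≤ m → 1 ≤ n →
        (a ^ 2)⁻¹ * sphereEigenvalue κ₁ 1 κ₃ (m - 1) (n - 1) < lam) := by
  constructor
  · obtain ⟨lam, -, hp⟩ := exists_isEllipsoidEigenvalue hab hbc hc κ₁ κ₂ κ₃ m n
    exact ⟨lam, hp, fun lam' hp' => IsEllipsoidEigenvalue.unique hab hbc hc hp' hp⟩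
  intro lam hp
  refine ⟨fun hκ => ?_, fun _ => hp.lt_sphereEigenvalue hab hbc hc, fun hκ hm hn => ?_⟩
  · subst hκ
    exact ⟨hp.sphereEigenvalue_lt hab hbc hc, hp.lt_sphereEigenvalue hab hbc hc⟩
  · subst hκ
    obtain ⟨m, rfl⟩ := Nat.exists_eq_add_of_le' hm
    obtain ⟨n, rfl⟩ := Nat.exists_eq_add_of_le' hn
    -- The Dirichlet problem with m and n zeros has smaller targets than the Neumann one with m + 1
    -- and n + 1, so its lower bound carries over.
    obtain ⟨lam', -, hp'⟩ := exists_isEllipsoidEigenvalue hab hbc hc κ₁ 1 κ₃ m n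
    rw [Nat.add_sub_cancel, Nat.add_sub_cancel]
    exact (hp'.sphereEigenvalue_lt hab hbc hc).trans_le (hp.le_of_target_le hab hbc hc hp'
      (targetAngle_one_lt m).le (targetAngle_one_lt n).le)
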